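/- Let $G_1,\dots,G_k$ be finite simple plane graphs, i.e. simple graphs with fixed embeddings in the plane, where the vertices of $G_i$ are labelled $1,\dots,n_i$. An orientation of a plane graph is called Pfaffian if each simple loop enclosing a bounded face (that is, each cycle that lies on the boundary of a bounded face $f$ and has $f$ in its interior) has an odd number of clockwise oriented edges. For orientations $\mathcal{O}_1,\dots,\mathcal{O}_k$ of $G_1,\dots,G_k$, the oriented Cartesian product $(P,\mathcal{O})$ is the Cartesian product $P=G_1\square\cdots\square G_k$ with the following orientation: for each $i\in\{1,\dots,k\}$, if $u_i\to u_i'$ in $\mathcal{O}_i$, then $(u_1,\dots,u_i,\dots,u_k)\to(u_1,\dots,u_i',\dots,u_k)$ in $\mathcal{O}$ if $u_{i+1}+\cdots+u_k+(k-i)\equiv 0\pmod 2$, and $(u_1,\dots,u_i',\dots,u_k)\to(u_1,\dots,u_i,\dots,u_k)$ otherwise. Given vertex weights $x(v)$ for $v\in V(P)$ and edge weights $a_{v,v'}=a_{v',v}$ for $\{v,v'\}\in E(P)$, with values in a commutative ring, the generalised adjacency matrix $\mathcal{K}_P$ of $(P,\mathcal{O})$ is the matrix indexed by $V(P)$ with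 \[ \mathcal{K}_P(v,v')=\begin{cases} x(v) & v=v',\\ a_{v,v'} & v\to v' \text{ in } \mathcal{O},\\ -a_{v,v'} & v'\to v \text{ in } \mathcal{O},\\ 0 & \text{otherwise.}\end{cases} \] Then, for fixed plane graphs $G_1,\dots,G_k$ and fixed weights $x$ and $a$, the determinant $\det\mathcal{K}_P$ does not depend on the choice of the Pfaffian orientations $\mathcal{O}_1,\dots,\mathcal{O}_k$: if $\mathcal{O}_i$ and $\mathcal{O}_i'$ are Pfaffian orientations of $G_i$ for $i=1,\dots,k$, then the two resulting matrices have the same determinant. -/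

import Mathlib

open scoped unitInterval

/-! ### Plane graphs -/

/-- An embedding of a simple graph in the plane `ℂ`: vertices go to distinct points, every edge is
drawn as a simple arc joining its endpoints (`arc` is indexed by directed edges, reversing the
direction reverses the arc), the interior of an arc contains no vertex, and arcs of different edges
meet at most in endpoints. -/
structure PlaneEmbedding {V : Type*} (G : SimpleGraph V) where
  pt : V → ℂ
  pt_injective : Function.Injective pt
  arc : ∀ {u v : V}, G.Adj u v → Path (pt u) (pt v)
  arc_symm : ∀ {u v : V} (h : G.Adj u v), arc h.symm = (arc h).symm
  arc_injective : ∀ {u v : V} (h : G.Adj u v), Function.Injective (arc h)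
  arc_ne_pt : ∀ {u v : V} (h : G.Adj u v) (t : I) (w : V), arc h t = pt w → t = 0 ∨ t = 1
  arc_disjoint : ∀ {u v u' v' : V} (h : G.Adj u v) (h' : G.Adj u' v') (t t' : I),
    s(u, v) ≠ s(u', v') → arc h t = arc h' t' → t = 0 ∨ t = 1

namespace PlaneEmbedding

variable {V : Type*} {G : SimpleGraph V} (E : PlaneEmbedding G)

/-- The set of all points of the plane that lie on the drawing. -/
def drawing : Set ℂ :=
  Set.range E.pt ∪ {z | ∃ (u v : V) (h : G.Adj u v), z ∈ Set.range (E.arc h)}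

/-- The faces are the connected components of the complement of the drawing. -/
def IsFace (f : Set ℂ) : Prop :=
  ∃ z ∈ E.drawingᶜ, f = connectedComponentIn E.drawingᶜ z

/-- The curve in the plane traced by a walk. -/
noncomputable def curve : ∀ {u v : V}, G.Walk u v → Path (E.pt u) (E.pt v)
  | _, _, .nil => Path.refl _
  | _, _, .cons h p => (E.arc h).trans (curve p)

end PlaneEmbedding

/-- The closed curve `γ` avoids `z` and has winding number `m` around `z`: there is a continuous
branch `L` of `log (γ - z)` along `γ`, and it increases by `2πi m`. -/
def HasWindingNumber {p : ℂ} (γ : Path p p) (z : ℂ) (m : ℤ) : Prop :=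
  ∃ L : C(I, ℂ), (∀ t, γ t - z = Complex.exp (L t)) ∧
    L 1 - L 0 = 2 * Real.pi * Complex.I * (m : ℂ)

/-! ### Orientations -/

/-- An orientation of a simple graph; `dir u v` means that the edge `uv` is oriented `u → v`. -/
structure GraphOrientation {V : Type*} (G : SimpleGraph V) where
  dir : V → V → Prop
  adj_of_dir : ∀ {u v : V}, dir u v → G.Adj u v
  asymm : ∀ {u v : V}, dir u v → ¬ dir v u
  dir_or_dir : ∀ {u v : V}, G.Adj u v → dir u v ∨ dir v u

/-- The directed cycle `c` runs clockwise around the bounded face `f` and bounds it from outside: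
it lies on the boundary of `f` and has winding number `-1` around the points of `f`. -/
def PlaneEmbedding.EnclosesClockwise {V : Type*} {G : SimpleGraph V} (E : PlaneEmbedding G)
    {u : V} (c : G.Walk u u) (f : Set ℂ) : Prop :=
  c.IsCycle ∧ Set.range (E.curve c) ⊆ frontier f ∧
    ∀ z ∈ f, HasWindingNumber (E.curve c) z (-1)

open Classical in
/-- An orientation of a plane graph is Pfaffian if each simple loop enclosing a bounded face has an
odd number of clockwise oriented edges. (The loop is traversed clockwise, so that its clockwise
oriented edges are those that are oriented in the direction of traversal.) -/
def GraphOrientation.IsPfaffian {V : Type*} {G : SimpleGraph V} (O : GraphOrientation G)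
    (E : PlaneEmbedding G) : Prop :=
  ∀ f : Set ℂ, E.IsFace f → Bornology.IsBounded f →
    ∀ (u : V) (c : G.Walk u u), E.EnclosesClockwise c f →
      Odd (c.darts.countP fun d => O.dir d.fst d.snd)

open Classical in
/-- The generalised adjacency matrix of an oriented graph with vertex weights `x` and edge
weights `a` (only the values of `a` at edges matter). -/
noncomputable def GraphOrientation.genAdjMatrix {V : Type*} {G : SimpleGraph V}
    (O : GraphOrientation G) {R : Type*} [CommRing R] (x : V → R) (a : Sym2 V → R) :
    Matrix V V R :=
  Matrix.of fun v w =>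
    if v = w then x v
    else if O.dir v w then a s(v, w)
    else if O.dir w v then -a s(v, w)
    else 0

/-! ### Oriented Cartesian products -/

/-- The Cartesian product `G₁ □ ⋯ □ G_k`. -/
def cartesianProduct {k : ℕ} {V : Fin k → Type*} (G : ∀ i, SimpleGraph (V i)) :
    SimpleGraph (∀ i, V i) where
  Adj u v := ∃ i, (G i).Adj (u i) (v i) ∧ ∀ j, j ≠ i → u j = v j
  symm := ⟨fun _ _ ⟨i, h, h'⟩ => ⟨i, h.symm, fun j hj => (h' j hj).symm⟩⟩
  loopless := ⟨fun _ ⟨_, h, _⟩ => h.ne rfl⟩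

/-- `u_{i+1} + ⋯ + u_k + (k - i)` for a vertex `u` of a Cartesian product of graphs whose vertices
are labelled `1, …, n`. The vertex `m : Fin n` carries the label `m + 1`, and the (zero-based) index
`i : Fin k` stands for the `(i + 1)`-st factor. -/
def labelSum {k : ℕ} {n : Fin k → ℕ} (i : Fin k) (u : ∀ j, Fin (n j)) : ℕ :=
  (∑ j ∈ Finset.Ioi i, ((u j : ℕ) + 1)) + (k - ((i : ℕ) + 1))

theorem labelSum_congr {k : ℕ} {n : Fin k → ℕ} {i : Fin k} {u v : ∀ j, Fin (n j)}
    (h : ∀ j, j ≠ i → u j = v j) : labelSum i u = labelSum i v := by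
  unfold labelSum
  congr 1
  refine Finset.sum_congr rfl fun j hj => ?_
  rw [h j (Finset.mem_Ioi.mp hj).ne']

/-- The orientation of the oriented Cartesian product: an edge in direction `i` is oriented as in
the `i`-th factor if `u_{i+1} + ⋯ + u_k + (k - i)` is even, and the other way round otherwise. -/
def orientedProduct {k : ℕ} {n : Fin k → ℕ} {G : ∀ i, SimpleGraph (Fin (n i))}
    (O : ∀ i, GraphOrientation (G i)) : GraphOrientation (cartesianProduct G) where
  dir u v := ∃ i, (∀ j, j ≠ i → u j = v j) ∧
    ((Even (labelSum i u) ∧ (O i).dir (u i) (v i)) ∨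
      (¬ Even (labelSum i u) ∧ (O i).dir (v i) (u i)))
  adj_of_dir := by
    rintro u v ⟨i, h, ⟨_, hd⟩ | ⟨_, hd⟩⟩
    · exact ⟨i, (O i).adj_of_dir hd, h⟩
    · exact ⟨i, ((O i).adj_of_dir hd).symm, h⟩
  asymm := by
    rintro u v ⟨i, h, hi⟩ ⟨j, h', hj⟩
    have hne : u i ≠ v i := by
      rcases hi with ⟨_, hd⟩ | ⟨_, hd⟩
      · exact ((O i).adj_of_dir hd).ne
      · exact ((O i).adj_of_dir hd).ne'
    obtain rfl : i = j := by
      by_contra hij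
      exact hne (h' i hij).symm
    rw [labelSum_congr h] at hi
    rcases hi with ⟨he, hd⟩ | ⟨he, hd⟩ <;> rcases hj with ⟨he', hd'⟩ | ⟨he', hd'⟩
    · exact (O i).asymm hd hd'
    · exact he' he
    · exact he he'
    · exact (O i).asymm hd hd'
  dir_or_dir := by
    rintro u v ⟨i, hadj, h⟩
    have h' : ∀ j, j ≠ i → v j = u j := fun j hj => (h j hj).symm
    have hs : labelSum i u = labelSum i v := labelSum_congr h
    by_cases he : Even (labelSum i u)
    · rcases (O i).dir_or_dir hadj with hd | hd
      · exact Or.inl ⟨i, h, Or.inl ⟨he, hd⟩⟩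
      · exact Or.inr ⟨i, h', Or.inl ⟨hs ▸ he, hd⟩⟩
    · rcases (O i).dir_or_dir hadj with hd | hd
      · exact Or.inr ⟨i, h', Or.inr ⟨hs ▸ he, hd⟩⟩
      · exact Or.inl ⟨i, h, Or.inr ⟨he, hd⟩⟩

/-! ### Continuous logarithms -/

/-! Compare two Pfaffian orientations of one plane graph and give each edge weight 1 in `ZMod 2` if
they disagree on it, 0 otherwise. Around a cycle enclosing a bounded face both have an odd number of
clockwise edges, so the weights sum to zero. If this extends to all cycles, the weight is a
difference of vertex labels: the orientations differ by switching at a set of vertices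
(`IsPfaffian.exists_switching`). In the product, take at each vertex the product of the switching
signs of its coordinates. Along an edge in direction `i` the other coordinates cancel, and the
parity twist is the same for both orientations. So the two matrices are conjugate by a diagonal sign
matrix and have equal determinants (`det_genAdjMatrix_eq_of_switching`).

The topological content is the extension to all cycles (`dartSum_eq_zero_of_enclosesClockwise`), by
induction on the number of edges that do not run outside the cycle. If two distinct vertices of the
cycle are joined by a path of inner edges, the cycle splits into two cycles with fewer such edges.
Otherwise a single face inside has the whole cycle on its boundary (`exists_face_of_no_chord`), and
the hypothesis applies to it.

Connectedness in the plane is obtained from Eilenberg's criterion: a compact set `K` does not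
separate `p` from `q` if `(z - p) / (z - q)` has a continuous logarithm on `K`
(`connectedComponentIn_eq_of_hasLogOn`). Logarithms on a drawing are glued from logarithms on arcs,
so separation becomes a question about sums along closed walks. The parts of the Jordan curve
theorem that are needed come from the same technique. -/

theorem two_pi_I_ne_zero' : (2 * Real.pi * Complex.I : ℂ) ≠ 0 := by
  simp [Real.pi_ne_zero, Complex.I_ne_zero]

/-- A continuous function with values in a discrete lattice is constant on preconnected sets. -/
theorem IsPreconnected.eq_of_mem_zmultiples {X : Type*} [TopologicalSpace X] {S : Set X}
    (hS : IsPreconnected S) {f : X → ℂ} (hf : ContinuousOn f S)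
    (h : ∀ x ∈ S, ∃ m : ℤ, f x = m * (2 * Real.pi * Complex.I)) {x y : X} (hx : x ∈ S)
    (hy : y ∈ S) : f x = f y := by
  wlog hle : (f x / (2 * Real.pi * Complex.I)).re ≤ (f y / (2 * Real.pi * Complex.I)).re
      generalizing x y
  · exact (this hy hx (le_of_not_ge hle)).symm
  have hc : ContinuousOn (fun x => (f x / (2 * Real.pi * Complex.I)).re) S :=
    Complex.continuous_re.comp_continuousOn (hf.div_const _)
  have key := hS.intermediate_value hx hy hc
  obtain ⟨m, hm⟩ := h x hx
  obtain ⟨l, hl⟩ := h y hy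
  have hval : ∀ {z : X} {j : ℤ}, f z = j * (2 * Real.pi * Complex.I) →
      (f z / (2 * Real.pi * Complex.I)).re = j := by
    intro z j hj
    rw [hj, mul_div_cancel_right₀ _ two_pi_I_ne_zero']
    simp
  simp only [hval hm, hval hl] at key hle
  have hml : m ≤ l := by exact_mod_cast hle
  rcases hml.eq_or_lt with rfl | hlt
  · rw [hm, hl]
  have h1 : (m : ℝ) + 1 ≤ l := by exact_mod_cast hlt
  -- If `m < l`, the half-integer `m + 1/2` would also be a value.
  obtain ⟨z, hz, hz'⟩ := key (a := (m : ℝ) + 1 / 2) ⟨by linarith, by linarith⟩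
  obtain ⟨j, hj⟩ := h z hz
  simp only [hval hj] at hz'
  have : (2 * j : ℝ) = 2 * m + 1 := by linarith
  have : (2 * j : ℤ) = 2 * m + 1 := by exact_mod_cast this
  omega

theorem exists_continuous_log {X : Type*} [TopologicalSpace X] [SimplyConnectedSpace X]
    [LocallyPathConnectedSpace X] {g : X → ℂ} (hg : Continuous g) (h0 : ∀ x, g x ≠ 0) :
    ∃ L : X → ℂ, Continuous L ∧ ∀ x, g x = Complex.exp (L x) := by
  obtain ⟨x₀⟩ : Nonempty X := inferInstance
  obtain ⟨F, ⟨-, hF⟩, -⟩ := Complex.isCoveringMapOn_exp.existsUnique_continuousMap_lifts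
    ⟨g, hg⟩ (a₀ := x₀) (Complex.exp_log (h0 x₀)) (fun x => by simpa using h0 x)
  exact ⟨F, F.continuous, fun x => (congr_fun hF x).symm⟩

theorem exists_continuous_log_unitInterval {g : I → ℂ} (hg : Continuous g) (h0 : ∀ t, g t ≠ 0) :
    ∃ L : I → ℂ, Continuous L ∧ ∀ t, g t = Complex.exp (L t) := by
  -- Extending `g` to the plane by a retraction onto the interval allows lifting through `exp` over
  -- `ℂ`, which is simply connected.
  have hc : Continuous fun z : ℂ => g (Set.projIcc 0 1 zero_le_one z.re) :=
    hg.comp (continuous_projIcc.comp Complex.continuous_re)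
  obtain ⟨L, hL, h⟩ := exists_continuous_log hc fun z => h0 _
  refine ⟨fun t => L (t : ℝ), by fun_prop, fun t => ?_⟩
  rw [← h]
  simp

/-- `f` has a continuous logarithm on `K`. -/
def HasLogOn (f : ℂ → ℂ) (K : Set ℂ) : Prop :=
  ∃ L : ℂ → ℂ, ContinuousOn L K ∧ ∀ z ∈ K, f z = Complex.exp (L z)

open Classical in
/-- The increment of a continuous logarithm along a nonvanishing function on `[0, 1]`. -/
noncomputable def logInc (g : I → ℂ) : ℂ :=
  if h : ∃ L : I → ℂ, Continuous L ∧ ∀ t, g t = Complex.exp (L t) then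
    h.choose 1 - h.choose 0
  else 0

/-- Two continuous logarithms of the same function differ by a continuous function with values in
`2πiℤ`, hence by a constant, so the increment is independent of the choice. -/
theorem logInc_eq {g L : I → ℂ} (hL : Continuous L) (h : ∀ t, g t = Complex.exp (L t)) :
    logInc g = L 1 - L 0 := by
  have hex : ∃ L : I → ℂ, Continuous L ∧ ∀ t, g t = Complex.exp (L t) := ⟨L, hL, h⟩
  rw [logInc, dif_pos hex]
  obtain ⟨hM, hM'⟩ := hex.choose_spec
  set M := hex.choose
  have := isPreconnected_univ.eq_of_mem_zmultiples (f := fun t => M t - L t)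
    (hM.sub hL).continuousOn (fun t _ => by
      obtain ⟨m, hm⟩ := Complex.exp_eq_exp_iff_exists_int.1 ((hM' t).symm.trans (h t))
      exact ⟨m, by rw [hm]; ring⟩) (Set.mem_univ 1) (Set.mem_univ 0)
  linear_combination this

section LogInc

variable {g g' : I → ℂ}

theorem exp_logInc (hg : Continuous g) (h0 : ∀ t, g t ≠ 0) :
    Complex.exp (logInc g) = g 1 / g 0 := by
  obtain ⟨L, hL, h⟩ := exists_continuous_log_unitInterval hg h0
  rw [logInc_eq hL h, Complex.exp_sub, h 1, h 0]

theorem exists_logInc_eq_of_closed (hg : Continuous g) (h0 : ∀ t, g t ≠ 0) (h : g 0 = g 1) :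
    ∃ m : ℤ, logInc g = m * (2 * Real.pi * Complex.I) := by
  have := exp_logInc hg h0
  rwa [h, div_self (h0 1), Complex.exp_eq_one_iff] at this

theorem logInc_mul (hg : Continuous g) (h0 : ∀ t, g t ≠ 0) (hg' : Continuous g')
    (h0' : ∀ t, g' t ≠ 0) : logInc (fun t => g t * g' t) = logInc g + logInc g' := by
  obtain ⟨L, hL, h⟩ := exists_continuous_log_unitInterval hg h0
  obtain ⟨L', hL', h'⟩ := exists_continuous_log_unitInterval hg' h0'
  rw [logInc_eq hL h, logInc_eq hL' h', logInc_eq (hL.add hL')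
    fun t => by rw [h, h', Pi.add_apply, Complex.exp_add]]
  simp only [Pi.add_apply]
  ring

theorem logInc_zpow (hg : Continuous g) (h0 : ∀ t, g t ≠ 0) (n : ℤ) :
    logInc (fun t => g t ^ n) = n * logInc g := by
  obtain ⟨L, hL, h⟩ := exists_continuous_log_unitInterval hg h0
  rw [logInc_eq hL h, logInc_eq (L := fun t => n * L t) (by fun_prop)
    fun t => by rw [h, Complex.exp_int_mul]]
  ring

theorem logInc_div (hg : Continuous g) (h0 : ∀ t, g t ≠ 0) (hg' : Continuous g')
    (h0' : ∀ t, g' t ≠ 0) : logInc (fun t => g t / g' t) = logInc g - logInc g' := by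
  have h1 := logInc_zpow hg' h0' (-1)
  simp only [zpow_neg_one] at h1
  simp only [div_eq_mul_inv]
  rw [logInc_mul hg h0 (g' := fun t => (g' t)⁻¹) (hg'.inv₀ h0') (fun t => inv_ne_zero (h0' t)), h1]
  push_cast
  ring

theorem logInc_symm (hg : Continuous g) (h0 : ∀ t, g t ≠ 0) :
    logInc (fun t => g (σ t)) = -logInc g := by
  obtain ⟨L, hL, h⟩ := exists_continuous_log_unitInterval hg h0
  rw [logInc_eq hL h, logInc_eq (L := fun t => L (σ t)) (by fun_prop) fun t => by rw [h]]
  simp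

theorem logInc_comp_slitPlane {f : I → ℂ} (hf : Continuous f) (h : ∀ t, f t ∈ Complex.slitPlane) :
    logInc f = Complex.log (f 1) - Complex.log (f 0) := by
  refine logInc_eq (L := fun t => Complex.log (f t)) (hf.clog h) fun t => ?_
  rw [Complex.exp_log (Complex.slitPlane_ne_zero (h t))]

theorem logInc_trans {a b c : ℂ} (γ : Path a b) (δ : Path b c) {f : ℂ → ℂ}
    (hγ : Continuous fun t => f (γ t)) (hδ : Continuous fun t => f (δ t))
    (h0 : ∀ t, f (γ t) ≠ 0) (h0' : ∀ t, f (δ t) ≠ 0) :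
    logInc (fun t => f (γ.trans δ t)) =
      logInc (fun t => f (γ t)) + logInc (fun t => f (δ t)) := by
  obtain ⟨L, hL, h⟩ := exists_continuous_log_unitInterval hγ h0
  obtain ⟨M, hM, h'⟩ := exists_continuous_log_unitInterval hδ h0'
  -- The two logarithms differ at the junction by a multiple of `2πi`; shifting the second by it
  -- makes them paths that can be concatenated.
  have hexp : Complex.exp (L 1 - M 0) = 1 := by
    rw [Complex.exp_sub, ← h, ← h', γ.target, δ.source]
    exact div_self (by simpa using h0 1)
  let P : Path (L 0) (L 1) := ⟨⟨L, hL⟩, rfl, rfl⟩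
  let Q : Path (L 1) (M 1 + (L 1 - M 0)) :=
    ⟨⟨fun t => M t + (L 1 - M 0), by fun_prop⟩, by simp, by simp⟩
  rw [logInc_eq hL h, logInc_eq hM h', logInc_eq (L := P.trans Q) (P.trans Q).continuous]
  · simp only [Path.source, Path.target]
    ring
  · intro t
    rw [Path.trans_apply, Path.trans_apply]
    split_ifs
    · exact h _
    · change _ = Complex.exp (M _ + (L 1 - M 0))
      rw [Complex.exp_add, hexp, mul_one]
      exact h' _

end LogInc

/-! ### Winding numbers of paths -/

/-- The increment of `log (γ - z)` along a path `γ`. -/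
noncomputable def Path.logIncAt {a b : ℂ} (γ : Path a b) (z : ℂ) : ℂ :=
  logInc fun t => γ t - z

theorem HasLogOn.logInc_eq {f : ℂ → ℂ} {K : Set ℂ} {L : ℂ → ℂ} (hL : ContinuousOn L K)
    (h : ∀ z ∈ K, f z = Complex.exp (L z)) {a b : ℂ} (γ : Path a b) (hγ : Set.range γ ⊆ K) :
    logInc (fun t => f (γ t)) = L b - L a := by
  rw [_root_.logInc_eq (L := fun t => L (γ t))]
  · simp
  · exact hL.comp_continuous γ.continuous fun t => hγ ⟨t, rfl⟩
  · exact fun t => h _ (hγ ⟨t, rfl⟩)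

namespace Path

variable {a b c : ℂ} (γ : Path a b) {z : ℂ}

theorem sub_ne_zero_of_notMem_range (hz : z ∉ Set.range γ) (t : I) : γ t - z ≠ 0 :=
  fun h => hz ⟨t, sub_eq_zero.1 h⟩

theorem exp_logIncAt (hz : z ∉ Set.range γ) :
    Complex.exp (γ.logIncAt z) = (b - z) / (a - z) := by
  rw [logIncAt, exp_logInc (by fun_prop) (γ.sub_ne_zero_of_notMem_range hz)]
  simp

theorem logIncAt_trans (δ : Path b c) (hγ : z ∉ Set.range γ) (hδ : z ∉ Set.range δ) :
    (γ.trans δ).logIncAt z = γ.logIncAt z + δ.logIncAt z :=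
  logInc_trans γ δ (f := fun w => w - z) (by fun_prop) (by fun_prop)
    (γ.sub_ne_zero_of_notMem_range hγ) (δ.sub_ne_zero_of_notMem_range hδ)

theorem logIncAt_symm (hγ : z ∉ Set.range γ) : γ.symm.logIncAt z = -γ.logIncAt z :=
  logInc_symm (g := fun t => γ t - z) (by fun_prop) (γ.sub_ne_zero_of_notMem_range hγ)

theorem logIncAt_refl : (Path.refl a).logIncAt z = 0 := by
  by_cases h : a = z
  -- The function vanishes here and has no logarithm, so the default value 0 of `logInc` is what
  -- makes the statement true.
  · rw [logIncAt, logInc, dif_neg]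
    rintro ⟨L, -, h'⟩
    exact Complex.exp_ne_zero _ ((h' 0).symm.trans (by simp [h]))
  · rw [logIncAt, logInc_eq (L := fun _ => Complex.log (a - z)) continuous_const]
    · simp
    · intro t
      rw [Complex.exp_log (sub_ne_zero.2 h)]
      simp

theorem exists_logIncAt_eq {a : ℂ} (γ : Path a a) (hz : z ∉ Set.range γ) :
    ∃ m : ℤ, γ.logIncAt z = m * (2 * Real.pi * Complex.I) :=
  exists_logInc_eq_of_closed (by fun_prop) (γ.sub_ne_zero_of_notMem_range hz) (by simp)

theorem hasWindingNumber_iff {a : ℂ} (γ : Path a a) (hz : z ∉ Set.range γ) {m : ℤ} :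
    HasWindingNumber γ z m ↔ γ.logIncAt z = m * (2 * Real.pi * Complex.I) := by
  constructor
  · rintro ⟨L, hL, h⟩
    rw [logIncAt, logInc_eq L.continuous hL, h]
    ring
  · intro h
    obtain ⟨L, hL, hL'⟩ := exists_continuous_log_unitInterval (g := fun t => γ t - z)
      (by fun_prop) (γ.sub_ne_zero_of_notMem_range hz)
    refine ⟨⟨L, hL⟩, hL', ?_⟩
    rw [logIncAt, logInc_eq hL hL'] at h
    simp only [ContinuousMap.coe_mk]
    rw [h]
    ring

theorem isClosed_range : IsClosed (Set.range γ) :=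
  (isCompact_range γ.continuous).isClosed

/-- Factor `γ - w = (γ - z) (1 - (w - z) / (γ - z))`. The second factor stays within distance 1 of
1, where the principal logarithm is continuous. The explicit correction gives continuity in `w`. -/
theorem logIncAt_eq_of_norm_lt {w : ℂ} (hz : z ∉ Set.range γ)
    (h : ∀ t, ‖w - z‖ < ‖γ t - z‖) :
    γ.logIncAt w = γ.logIncAt z +
      (Complex.log (1 - (w - z) / (b - z)) - Complex.log (1 - (w - z) / (a - z))) := by
  have h0 := γ.sub_ne_zero_of_notMem_range hz
  have hs : ∀ t, 1 - (w - z) / (γ t - z) ∈ Complex.slitPlane := by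
    intro t
    rw [sub_eq_add_neg]
    refine Complex.mem_slitPlane_of_norm_lt_one ?_
    rw [norm_neg, norm_div, div_lt_one (norm_pos_iff.2 (h0 t))]
    exact h t
  have hc : Continuous fun t => 1 - (w - z) / (γ t - z) :=
    continuous_const.sub (continuous_const.div (by fun_prop) h0)
  have := logInc_comp_slitPlane hc hs
  simp only [Path.source, Path.target] at this
  rw [← this, logIncAt, logIncAt,
    ← logInc_mul (by fun_prop) h0 hc fun t => Complex.slitPlane_ne_zero (hs t)]
  congr 1
  ext t
  have := h0 t
  field_simp
  ring

theorem continuousAt_logIncAt (hz : z ∉ Set.range γ) : ContinuousAt γ.logIncAt z := by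
  obtain ⟨ε, hε, hball⟩ := Metric.isOpen_iff.1 γ.isClosed_range.isOpen_compl z hz
  have hlt : ∀ w ∈ Metric.ball z ε, ∀ t, ‖w - z‖ < ‖γ t - z‖ := by
    intro w hw t
    rw [Metric.mem_ball, dist_eq_norm] at hw
    refine hw.trans_le (le_of_not_gt fun hlt => ?_)
    exact hball (by rwa [Metric.mem_ball, dist_eq_norm] : γ t ∈ Metric.ball z ε) ⟨t, rfl⟩
  have : ContinuousAt (fun w => γ.logIncAt z +
      (Complex.log (1 - (w - z) / (b - z)) - Complex.log (1 - (w - z) / (a - z)))) z := by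
    have h1 : ∀ c : ℂ, ContinuousAt (fun w => Complex.log (1 - (w - z) / c)) z := by
      intro c
      refine ContinuousAt.clog (by fun_prop) (by simp)
    exact continuousAt_const.add ((h1 _).sub (h1 _))
  refine this.congr ?_
  filter_upwards [Metric.ball_mem_nhds z hε] with w hw
  exact (γ.logIncAt_eq_of_norm_lt hz (hlt w hw)).symm

theorem logIncAt_eq_of_isPreconnected {a : ℂ} (γ : Path a a) {S : Set ℂ} (hS : IsPreconnected S)
    (h : Disjoint S (Set.range γ)) {z w : ℂ} (hz : z ∈ S) (hw : w ∈ S) :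
    γ.logIncAt z = γ.logIncAt w :=
  hS.eq_of_mem_zmultiples
    (fun _ hx => (γ.continuousAt_logIncAt (h.notMem_of_mem_left hx)).continuousWithinAt)
    (fun _ hx => γ.exists_logIncAt_eq (h.notMem_of_mem_left hx)) hz hw

/-- Factor `γ - z = (1 - γ / z) (-z)`: the first factor has a principal logarithm, which returns to
its initial value along a closed curve, and the second is constant. -/
theorem logIncAt_eq_zero_of_norm_lt {a : ℂ} (γ : Path a a) (h : ∀ t, ‖γ t‖ < ‖z‖) :
    γ.logIncAt z = 0 := by
  have hz : z ≠ 0 := norm_pos_iff.1 ((norm_nonneg _).trans_lt (h 0))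
  have hs : ∀ t, 1 - γ t / z ∈ Complex.slitPlane := by
    intro t
    rw [sub_eq_add_neg]
    refine Complex.mem_slitPlane_of_norm_lt_one ?_
    rw [norm_neg, norm_div, div_lt_one (norm_pos_iff.2 hz)]
    exact h t
  have hc : Continuous fun t => 1 - γ t / z := by fun_prop
  have h1 := logInc_comp_slitPlane hc hs
  have h2 := logInc_mul hc (fun t => Complex.slitPlane_ne_zero (hs t))
    (continuous_const (y := -z)) fun t => neg_ne_zero.2 hz
  have h3 := logInc_eq (g := fun _ => -z) (continuous_const (y := Complex.log (-z)))
    fun t => by rw [Complex.exp_log (neg_ne_zero.2 hz)]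
  rw [h1, h3] at h2
  rw [logIncAt]
  convert h2 using 1
  · congr 1
    ext t
    field_simp
    ring
  · simp

theorem exists_forall_logIncAt_eq_zero {a : ℂ} (γ : Path a a) :
    ∃ r : ℝ, ∀ z, r < ‖z‖ → γ.logIncAt z = 0 := by
  obtain ⟨r, hr⟩ := (isCompact_range γ.continuous).isBounded.exists_norm_le
  exact ⟨r, fun z hz => γ.logIncAt_eq_zero_of_norm_lt fun t => (hr _ ⟨t, rfl⟩).trans_lt hz⟩

end Path

/-! ### Separation of the plane by compact sets -/

/-- The circle around `p` of radius `r`, parametrized by the unit interval. -/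
noncomputable def circlePath (p : ℂ) (r : ℝ) : Path (p + r) (p + r) where
  toFun t := p + r * Complex.exp (2 * Real.pi * Complex.I * (t : ℝ))
  source' := by simp
  target' := by simp

theorem circlePath_apply (p : ℂ) (r : ℝ) (t : I) :
    circlePath p r t = p + r * Complex.exp (2 * Real.pi * Complex.I * (t : ℝ)) := rfl

theorem norm_circlePath_sub (p : ℂ) {r : ℝ} (hr : 0 < r) (t : I) :
    ‖circlePath p r t - p‖ = r := by
  have : (2 * Real.pi * Complex.I * (t : ℝ) : ℂ) = ((2 * Real.pi * t : ℝ) : ℂ) * Complex.I := by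
    push_cast; ring
  rw [circlePath_apply, add_sub_cancel_left, norm_mul, this, Complex.norm_exp_ofReal_mul_I,
    mul_one, Complex.norm_real, Real.norm_of_nonneg hr.le]

theorem logIncAt_circlePath (p : ℂ) {r : ℝ} (hr : 0 < r) :
    (circlePath p r).logIncAt p = 2 * Real.pi * Complex.I := by
  rw [Path.logIncAt, logInc_eq (L := fun t : I => Complex.log r +
    2 * Real.pi * Complex.I * (t : ℝ)) (by fun_prop)]
  · simp
  · intro t
    rw [circlePath_apply, Complex.exp_add, Complex.exp_log (by exact_mod_cast hr.ne')]
    ring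

theorem Complex.one_lt_rank_real : 1 < Module.rank ℝ ℂ := by simp

/-- A point of a bounded open set cannot be removed by a logarithm on a closed set containing the
frontier. -/
theorem eq_zero_of_zpow_eq_mul_exp {K U : Set ℂ} (hK : IsClosed K) (hU : IsOpen U)
    (hb : Bornology.IsBounded U) (hUK : frontier U ⊆ K) {p : ℂ} (hp : p ∈ U) {n : ℤ}
    {R L : ℂ → ℂ} (hR : ContinuousOn R (closure U)) (hR0 : ∀ z ∈ closure U, R z ≠ 0)
    (hL : ContinuousOn L K) (h : ∀ z ∈ K, (z - p) ^ n = R z * Complex.exp (L z)) : n = 0 := by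
  classical
  -- Tietze extension of the logarithm from `K` to the whole plane.
  obtain ⟨M, hM⟩ := ContinuousMap.exists_restrict_eq hK ⟨K.domRestrict L, hL.domRestrict⟩
  have hM' : ∀ z ∈ K, M z = L z := fun z hz => congrArg (fun f : C(K, ℂ) => f ⟨z, hz⟩) hM
  -- Inside `U` the power, which may vanish or have a pole at `p`, is replaced by a nonvanishing
  -- function with the same values on the frontier. Thus `F` has a global logarithm, and its
  -- increment `2πi n` along a circle surrounding `U` must be zero.
  let F : ℂ → ℂ := fun z => if z ∈ U then R z * Complex.exp (M z) else (z - p) ^ n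
  have hF1 : ∀ z ∈ closure U, F z = R z * Complex.exp (M z) := by
    intro z hz
    by_cases hzU : z ∈ U
    · exact if_pos hzU
    · have : z ∈ K := hUK ⟨hz, by rwa [hU.interior_eq]⟩
      simp only [F, if_neg hzU]
      rw [h z this, hM' z this]
  have hF2 : ∀ z ∈ Uᶜ, F z = (z - p) ^ n := fun z hz => if_neg hz
  have hne : ∀ z ∈ Uᶜ, z - p ≠ 0 := fun z hz h0 => hz (by rwa [sub_eq_zero.1 h0])
  have hFc : Continuous F := by
    have h1 : ContinuousOn F (closure U) :=
      (hR.mul (by fun_prop)).congr hF1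
    have h2 : ContinuousOn F Uᶜ :=
      ContinuousOn.congr (fun z hz => ContinuousAt.continuousWithinAt
        ((continuousAt_id.sub continuousAt_const).zpow₀ n (Or.inl (hne z hz)))) hF2
    have h3 := h1.union_of_isClosed h2 isClosed_closure hU.isClosed_compl
    rw [← continuousOn_univ]
    refine h3.mono fun z _ => ?_
    by_cases hz : z ∈ U
    · exact Or.inl (subset_closure hz)
    · exact Or.inr hz
  have hF0 : ∀ z, F z ≠ 0 := by
    intro z
    by_cases hz : z ∈ U
    · rw [hF1 z (subset_closure hz)]
      exact mul_ne_zero (hR0 z (subset_closure hz)) (Complex.exp_ne_zero _)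
    · rw [hF2 z hz]
      exact zpow_ne_zero _ (hne z hz)
  obtain ⟨N, hN, hFN⟩ := exists_continuous_log hFc hF0
  obtain ⟨r, hr⟩ := (Metric.isBounded_iff_subset_ball p).1 hb
  have hr0 : 0 < r := (dist_nonneg).trans_lt (hr hp)
  have h1 := HasLogOn.logInc_eq hN.continuousOn (fun z _ => hFN z) (circlePath p r)
    (Set.subset_univ _)
  have hout : ∀ t, circlePath p r t ∈ Uᶜ := by
    intro t ht
    have := hr ht
    rw [Metric.mem_ball, dist_eq_norm, norm_circlePath_sub p hr0] at this
    exact lt_irrefl _ this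
  simp only [hF2 _ (hout _), sub_self] at h1
  rw [logInc_zpow (by fun_prop) fun t => hne _ (hout t)] at h1
  have h2 := logIncAt_circlePath p hr0
  rw [Path.logIncAt] at h2
  rw [h2, mul_eq_zero, or_iff_left two_pi_I_ne_zero'] at h1
  exact_mod_cast h1

theorem isPreconnected_compl_closedBall (r : ℝ) (hr : 0 ≤ r) :
    IsPreconnected {z : ℂ | r < ‖z‖} := by
  have : {z : ℂ | r < ‖z‖} = (fun x : ℝ × ℂ => (x.1 : ℂ) * x.2) ''
      (Set.Ioi r ×ˢ Metric.sphere (0 : ℂ) 1) := by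
    ext z
    simp only [Set.mem_ofPred_eq, Set.mem_image, Set.mem_prod, Set.mem_Ioi, mem_sphere_iff_norm,
      sub_zero, Prod.exists]
    constructor
    · intro hz
      have h0 : 0 < ‖z‖ := hr.trans_lt hz
      refine ⟨‖z‖, z / ‖z‖, ⟨hz, ?_⟩, ?_⟩
      · rw [norm_div, Complex.norm_real, norm_norm, div_self h0.ne']
      · exact mul_div_cancel₀ _ (by exact_mod_cast h0.ne')
    · rintro ⟨s, w, ⟨hs, hw⟩, rfl⟩
      rw [norm_mul, hw, mul_one, Complex.norm_real, Real.norm_of_nonneg (hr.trans hs.le)]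
      exact hs
  rw [this]
  exact (isPreconnected_Ioi.prod (isConnected_sphere Complex.one_lt_rank_real 0
    zero_le_one).isPreconnected).image _ (by fun_prop)

section Separation

variable {K : Set ℂ}

/-- A frontier point off `K` would have an open component of its own that meets the given one, hence
equals it, and the point would be interior. -/
theorem frontier_connectedComponentIn_compl (hK : IsClosed K) (p : ℂ) :
    frontier (connectedComponentIn Kᶜ p) ⊆ K := by
  intro z hz
  by_contra hzK
  have hopen : ∀ x, IsOpen (connectedComponentIn Kᶜ x) :=
    fun x => hK.isOpen_compl.connectedComponentIn
  obtain ⟨w, hw, hw'⟩ := mem_closure_iff.1 hz.1 _ (hopen z) (mem_connectedComponentIn hzK)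
  have := (connectedComponentIn_eq hw).trans (connectedComponentIn_eq hw').symm
  exact hz.2 (by rw [(hopen p).interior_eq, ← this]; exact mem_connectedComponentIn hzK)

theorem connectedComponentIn_eq_of_not_isBounded (hK : IsCompact K) {p q : ℂ}
    (hp : ¬ Bornology.IsBounded (connectedComponentIn Kᶜ p))
    (hq : ¬ Bornology.IsBounded (connectedComponentIn Kᶜ q)) :
    connectedComponentIn Kᶜ p = connectedComponentIn Kᶜ q := by
  obtain ⟨r, hr0, hr⟩ := hK.isBounded.exists_pos_norm_le
  have hsub : {z : ℂ | r < ‖z‖} ⊆ Kᶜ := fun z hz hzK => (hr z hzK).not_gt hz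
  have hmem : ∀ p, ¬ Bornology.IsBounded (connectedComponentIn Kᶜ p) →
      ∃ z ∈ connectedComponentIn Kᶜ p, r < ‖z‖ := by
    intro p hp
    by_contra! hcon
    exact hp (isBounded_iff_forall_norm_le.2 ⟨r, hcon⟩)
  obtain ⟨z, hz, hzr⟩ := hmem p hp
  obtain ⟨w, hw, hwr⟩ := hmem q hq
  rw [connectedComponentIn_eq hz, connectedComponentIn_eq hw]
  exact connectedComponentIn_eq ((isPreconnected_compl_closedBall r hr0.le).subset_connectedComponentIn
    hzr hsub hwr)

theorem notMem_closure_connectedComponentIn (hK : IsClosed K) {p q : ℂ} (hq : q ∉ K)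
    (hne : connectedComponentIn Kᶜ p ≠ connectedComponentIn Kᶜ q) :
    q ∉ closure (connectedComponentIn Kᶜ p) := by
  intro h
  by_cases hqp : q ∈ connectedComponentIn Kᶜ p
  · exact hne (connectedComponentIn_eq hqp)
  · exact hq (frontier_connectedComponentIn_compl hK p ⟨h, fun h' => hqp (interior_subset h')⟩)

/-- If `(z - p) / (z - q)` has a continuous logarithm on the compact set `K`, then `K` does not
separate `p` and `q`. -/
theorem connectedComponentIn_eq_of_hasLogOn (hK : IsCompact K) {p q : ℂ} (hp : p ∉ K) (hq : q ∉ K)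
    (h : HasLogOn (fun z => (z - p) / (z - q)) K) :
    connectedComponentIn Kᶜ p = connectedComponentIn Kᶜ q := by
  by_contra hne
  obtain ⟨L, hL, hL'⟩ := h
  have hpz : ∀ z ∈ K, z - p ≠ 0 := fun z hz h0 => hp (by rwa [← sub_eq_zero.1 h0])
  have hqz : ∀ z ∈ K, z - q ≠ 0 := fun z hz h0 => hq (by rwa [← sub_eq_zero.1 h0])
  -- If the components differ, `z - q` has no zero on the closure of the component of `p`, so a
  -- bounded component would contradict `eq_zero_of_zpow_eq_mul_exp` with `n = 1`. By symmetry both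
  -- are unbounded, but there is only one unbounded component.
  have key : ∀ {p q : ℂ} {L : ℂ → ℂ}, p ∉ K → q ∉ K →
      connectedComponentIn Kᶜ p ≠ connectedComponentIn Kᶜ q → ContinuousOn L K →
      (∀ z ∈ K, z - p = (z - q) * Complex.exp (L z)) →
      ¬ Bornology.IsBounded (connectedComponentIn Kᶜ p) := by
    intro p q L hp hq hne hL h hb
    refine one_ne_zero (eq_zero_of_zpow_eq_mul_exp (n := 1) (R := fun z => z - q) hK.isClosed
      hK.isClosed.isOpen_compl.connectedComponentIn hb
      (frontier_connectedComponentIn_compl hK.isClosed p) (mem_connectedComponentIn hp)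
      (by fun_prop) (fun z hz h0 => ?_) hL (fun z hz => by rw [zpow_one, h z hz]))
    rw [sub_eq_zero.1 h0] at hz
    exact notMem_closure_connectedComponentIn hK.isClosed hq hne hz
  refine hne (connectedComponentIn_eq_of_not_isBounded hK
    (key hp hq hne hL fun z hz => ?_) (key hq hp (Ne.symm hne) hL.neg fun z hz => ?_))
  · rw [← hL' z hz, mul_div_cancel₀ _ (hqz z hz)]
  · rw [Pi.neg_apply, Complex.exp_neg, ← hL' z hz, inv_div, mul_div_cancel₀ _ (hpz z hz)]

/-- Every nonvanishing continuous function on `K` has a continuous logarithm. -/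
def LogTrivial (K : Set ℂ) : Prop :=
  ∀ f : ℂ → ℂ, ContinuousOn f K → (∀ z ∈ K, f z ≠ 0) → HasLogOn f K

theorem LogTrivial.isPreconnected_compl (hK : IsCompact K) (h : LogTrivial K) :
    IsPreconnected Kᶜ := by
  refine isPreconnected_of_forall_pair fun p hp q hq =>
    ⟨connectedComponentIn Kᶜ p, connectedComponentIn_subset _ _, mem_connectedComponentIn hp, ?_,
      isPreconnected_connectedComponentIn⟩
  have hqz : ∀ z ∈ K, z - q ≠ 0 := fun z hz h0 => hq (by rwa [← sub_eq_zero.1 h0])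
  rw [connectedComponentIn_eq_of_hasLogOn hK hp hq]
  · exact mem_connectedComponentIn hq
  · refine h _ (by fun_prop (disch := exact hqz)) fun z hz => div_ne_zero (fun h0 => hp ?_) (hqz z hz)
    rwa [← sub_eq_zero.1 h0]

theorem LogTrivial.image {φ : I → ℂ} (hφ : Continuous φ) (hinj : Function.Injective φ) {s t : I}
    (hst : s ≤ t) : LogTrivial (φ '' Set.Icc s t) := by
  intro f hf h0
  -- The retraction onto `[s, t]` makes the pulled back function defined and nonvanishing on the
  -- whole interval.
  let ρ : I → I := fun x => Set.projIcc s t hst x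
  have hρ : Continuous ρ := continuous_subtype_val.comp continuous_projIcc
  have hmem : ∀ x, φ (ρ x) ∈ φ '' Set.Icc s t := fun x => ⟨_, (Set.projIcc s t hst x).2, rfl⟩
  obtain ⟨L, hL, h⟩ := exists_continuous_log_unitInterval (g := fun x => f (φ (ρ x)))
    (hf.comp_continuous (hφ.comp hρ) hmem) fun x => h0 _ (hmem x)
  have hemb : Topology.IsClosedEmbedding φ := hφ.isClosedEmbedding hinj
  refine ⟨fun z => L (Function.invFun φ z), ?_, ?_⟩
  · rw [continuousOn_iff_continuous_domRestrict]
    have hsub : φ '' Set.Icc s t ⊆ Set.range φ := Set.image_subset_range _ _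
    have hinv : Continuous fun z : Set.range φ => Function.invFun φ (z : ℂ) := by
      have := (hemb.isEmbedding.toHomeomorph).symm.continuous
      refine this.congr fun z => ?_
      obtain ⟨x, hx⟩ := z.2
      apply hinj
      rw [Function.invFun_eq ⟨x, hx⟩]
      exact congrArg Subtype.val (hemb.isEmbedding.toHomeomorph.apply_symm_apply z)
    exact hL.comp (hinv.comp (continuous_inclusion hsub))
  · rintro _ ⟨x, hx, rfl⟩
    beta_reduce
    rw [Function.leftInverse_invFun hinj x, ← h]
    simp only [ρ]
    rw [Set.projIcc_of_mem _ hx]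

theorem LogTrivial.range {φ : I → ℂ} (hφ : Continuous φ) (hinj : Function.Injective φ) :
    LogTrivial (Set.range φ) := by
  rw [← Set.image_univ, show (Set.univ : Set I) = Set.Icc 0 1 from by
    ext x; simp [unitInterval.le_one']]
  exact LogTrivial.image hφ hinj zero_le_one

theorem LogTrivial.singleton (a : ℂ) : LogTrivial {a} := fun f _ h0 =>
  ⟨fun _ => Complex.log (f a), continuousOn_const, fun z hz => by
    rw [Set.mem_singleton_iff.1 hz, Complex.exp_log (h0 a rfl)]⟩

theorem HasLogOn.of_eq_on_inter {A B : Set ℂ} (hA : IsClosed A) (hB : IsClosed B) {f L M : ℂ → ℂ}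
    (hL : ContinuousOn L A) (hM : ContinuousOn M B) (hfL : ∀ z ∈ A, f z = Complex.exp (L z))
    (hfM : ∀ z ∈ B, f z = Complex.exp (M z)) (h : ∀ z ∈ A ∩ B, L z = M z) : HasLogOn f (A ∪ B) := by
  classical
  have hB' : ∀ z ∈ B, (if z ∈ A then L z else M z) = M z := by
    intro z hz
    split_ifs with hzA
    · exact h z ⟨hzA, hz⟩
    · rfl
  refine ⟨fun z => if z ∈ A then L z else M z, ?_, ?_⟩
  · exact (hL.congr fun z hz => if_pos hz).union_of_isClosed (hM.congr hB') hA hB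
  · rintro z (hz | hz)
    · simp only [if_pos hz]
      exact hfL z hz
    · beta_reduce
      rw [hB' z hz]
      exact hfM z hz

/-- At the single common point the two logarithms differ by a multiple of `2πi`; shifting one of
them by it makes them agree on the intersection. -/
theorem LogTrivial.union {A B : Set ℂ} (hA : LogTrivial A) (hB : LogTrivial B) (hcA : IsClosed A)
    (hcB : IsClosed B) {a : ℂ} (ha : a ∈ A ∩ B) (h : ∀ z ∈ A ∩ B, z = a) : LogTrivial (A ∪ B) := by
  intro f hf h0
  obtain ⟨L, hL, hfL⟩ := hA f (hf.mono Set.subset_union_left) fun z hz => h0 z (Or.inl hz)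
  obtain ⟨M, hM, hfM⟩ := hB f (hf.mono Set.subset_union_right) fun z hz => h0 z (Or.inr hz)
  refine HasLogOn.of_eq_on_inter hcA hcB (M := fun z => M z + (L a - M a)) hL (by fun_prop) hfL
    (fun z hz => ?_) (fun z hz => ?_)
  · rw [Complex.exp_add, Complex.exp_sub, ← hfL a ha.1, ← hfM a ha.2, div_self (h0 a (Or.inl ha.1)),
      mul_one, hfM z hz]
  · rw [h z hz]
    ring

end Separation

/-! ### The Jordan curve theorem -/

namespace Path

variable {a : ℂ} (γ : Path a a)

/-- The points around which the closed curve `γ` has nonzero winding number. -/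
def inside : Set ℂ := {z | z ∉ Set.range γ ∧ γ.logIncAt z ≠ 0}

/-- The points off the closed curve `γ` around which it has winding number zero. -/
def outside : Set ℂ := {z | z ∉ Set.range γ ∧ γ.logIncAt z = 0}

theorem disjoint_inside_outside : Disjoint γ.inside γ.outside :=
  Set.disjoint_left.2 fun _ h h' => h.2 h'.2

theorem inside_union_outside : γ.inside ∪ γ.outside = (Set.range γ)ᶜ := by
  ext z
  simp only [inside, outside, Set.mem_union, Set.mem_ofPred_eq, Set.mem_compl_iff]
  tauto

theorem logIncAt_eventually_eq {z : ℂ} (hz : z ∉ Set.range γ) :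
    ∀ᶠ w in nhds z, w ∉ Set.range γ ∧ γ.logIncAt w = γ.logIncAt z := by
  obtain ⟨ε, hε, hball⟩ := Metric.isOpen_iff.1 γ.isClosed_range.isOpen_compl z hz
  filter_upwards [Metric.ball_mem_nhds z hε] with w hw
  exact ⟨hball hw, γ.logIncAt_eq_of_isPreconnected (convex_ball z ε).isPreconnected
    (Set.disjoint_left.2 hball) hw (Metric.mem_ball_self hε)⟩

theorem isOpen_inside : IsOpen γ.inside :=
  isOpen_iff_eventually.2 fun _ hz => (γ.logIncAt_eventually_eq hz.1).mono
    fun _ hw => ⟨hw.1, hw.2 ▸ hz.2⟩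

theorem isOpen_outside : IsOpen γ.outside :=
  isOpen_iff_eventually.2 fun _ hz => (γ.logIncAt_eventually_eq hz.1).mono
    fun _ hw => ⟨hw.1, hw.2.trans hz.2⟩

theorem exists_forall_mem_outside : ∃ r : ℝ, 0 ≤ r ∧ ∀ z, r < ‖z‖ → z ∈ γ.outside := by
  obtain ⟨r, hr⟩ := γ.exists_forall_logIncAt_eq_zero
  obtain ⟨s, hs0, hs⟩ := (isCompact_range γ.continuous).isBounded.exists_pos_norm_le
  exact ⟨max r s, hs0.le.trans (le_max_right _ _), fun z hz =>
    ⟨fun h => ((le_max_right r s).trans_lt hz).not_ge (hs z h), hr z ((le_max_left _ _).trans_lt hz)⟩⟩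

theorem isBounded_inside : Bornology.IsBounded γ.inside := by
  obtain ⟨r, -, hr⟩ := γ.exists_forall_mem_outside
  refine isBounded_iff_forall_norm_le.2 ⟨r, fun z hz => le_of_not_gt fun h => ?_⟩
  exact hz.2 (hr z h).2

theorem closure_inside_subset : closure γ.inside ⊆ γ.inside ∪ Set.range γ := by
  intro z hz
  by_contra h
  simp only [Set.mem_union, not_or] at h
  have hz' : z ∈ γ.outside := by
    have : z ∈ (Set.range γ)ᶜ := h.2
    rw [← inside_union_outside] at this
    exact this.resolve_left h.1
  obtain ⟨w, hw, hw'⟩ := mem_closure_iff.1 hz _ γ.isOpen_outside hz'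
  exact γ.disjoint_inside_outside.le_bot ⟨hw', hw⟩

theorem closure_outside_subset : closure γ.outside ⊆ γ.outside ∪ Set.range γ := by
  intro z hz
  by_contra h
  simp only [Set.mem_union, not_or] at h
  have hz' : z ∈ γ.inside := by
    have : z ∈ (Set.range γ)ᶜ := h.2
    rw [← inside_union_outside] at this
    exact this.resolve_right h.1
  obtain ⟨w, hw, hw'⟩ := mem_closure_iff.1 hz _ γ.isOpen_inside hz'
  exact γ.disjoint_inside_outside.le_bot ⟨hw, hw'⟩

end Path

/-- The closed curve `A.trans B` is a simple closed curve, in the sense that is used below: `A` is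
an arc, `B` meets it at the endpoints only and carries no cohomology. -/
structure IsJordanPair {a b : ℂ} (A : Path a b) (B : Path b a) : Prop where
  injective : Function.Injective A
  logTrivial : LogTrivial (Set.range B)
  inter_subset : Set.range A ∩ Set.range B ⊆ {a, b}

namespace IsJordanPair

variable {a b : ℂ} {A : Path a b} {B : Path b a}

theorem ne (h : IsJordanPair A B) : a ≠ b := fun hab =>
  zero_ne_one (h.injective (by rw [A.source, A.target, hab]) : (0 : I) = 1)

/-- If all winding numbers of the curve are divisible by `m`, then `(z - b) / (z - a)` has an `m`-th
root on `ℂ ∖ {a, b}`. -/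
theorem exists_logIncAt_not_dvd (h : IsJordanPair A B) {m : ℤ} (hm0 : m ≠ 0) (hm : ¬ IsUnit m) :
    ∃ z, z ∉ Set.range (A.trans B) ∧
      ∀ k : ℤ, (A.trans B).logIncAt z ≠ (m * k : ℤ) * (2 * Real.pi * Complex.I) := by
  classical
  by_contra! hcon
  have hmC : (m : ℂ) ≠ 0 := by exact_mod_cast hm0
  -- Off both arcs the two formulas agree, because the winding number of the closed curve is
  -- divisible by `m`. So `f` is continuous away from `a` and `b`, and its `m`-th power is `(z - b)
  -- / (z - a)`.
  let f : ℂ → ℂ := fun z => if z ∉ Set.range A then Complex.exp (A.logIncAt z / m)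
    else Complex.exp (-B.logIncAt z / m)
  have hfA : ∀ z ∉ Set.range A, f z = Complex.exp (A.logIncAt z / m) := fun z hz => if_pos hz
  have hfB : ∀ z ∉ Set.range B, f z = Complex.exp (-B.logIncAt z / m) := by
    intro z hz
    by_cases hzA : z ∈ Set.range A
    · exact if_neg (not_not.2 hzA)
    · rw [hfA z hzA]
      obtain ⟨k, hk⟩ := hcon z (by rw [Path.trans_range]; exact fun h => h.elim hzA hz)
      rw [Path.logIncAt_trans _ _ hzA hz] at hk
      refine Complex.exp_eq_exp_iff_exists_int.2 ⟨k, ?_⟩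
      field_simp
      push_cast at hk
      linear_combination hk
  have hcases : ∀ z, z ≠ a → z ≠ b → z ∉ Set.range A ∨ z ∉ Set.range B := by
    intro z hza hzb
    by_contra! hz
    rcases h.inter_subset hz with h | h
    exacts [hza h, hzb h]
  have hf0 : ∀ z, f z ≠ 0 := by
    intro z
    simp only [f]
    split_ifs <;> exact Complex.exp_ne_zero _
  have hfc : ∀ z, z ≠ a → z ≠ b → ContinuousAt f z := by
    intro z hza hzb
    rcases hcases z hza hzb with hz | hz
    · refine ContinuousAt.congr (f := fun z => Complex.exp (A.logIncAt z / m))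
        ((A.continuousAt_logIncAt hz).div_const _).cexp ?_
      filter_upwards [A.isClosed_range.isOpen_compl.mem_nhds hz] with w hw
      exact (hfA w hw).symm
    · refine ContinuousAt.congr (f := fun z => Complex.exp (-B.logIncAt z / m))
        ((B.continuousAt_logIncAt hz).neg.div_const _).cexp ?_
      filter_upwards [B.isClosed_range.isOpen_compl.mem_nhds hz] with w hw
      exact (hfB w hw).symm
  have hfm : ∀ z, z ≠ a → z ≠ b → f z ^ m = (z - b) / (z - a) := by
    intro z hza hzb
    have h1 : (z - b) / (z - a) = (b - z) / (a - z) := by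
      rw [← neg_sub, ← neg_sub a z, neg_div_neg_eq]
    rw [h1]
    rcases hcases z hza hzb with hz | hz
    · rw [hfA z hz, ← Complex.exp_int_mul, mul_div_cancel₀ _ hmC, A.exp_logIncAt hz]
    · rw [hfB z hz, ← Complex.exp_int_mul, mul_div_cancel₀ _ hmC, Complex.exp_neg,
        B.exp_logIncAt hz, inv_div]
  set r : ℝ := ‖b - a‖ / 2
  have hba : 0 < ‖b - a‖ := norm_pos_iff.2 (sub_ne_zero.2 h.ne.symm)
  have hr : 0 < r := by positivity
  -- This circle winds once around `a` and not around `b`. The increment of `f` along it is `2πi k`,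
  -- so `m * k = -1`, which is impossible for a nonunit.
  set C := circlePath a r
  have hC : ∀ t, ‖C t - a‖ = r := norm_circlePath_sub a hr
  have hCa : ∀ t, C t ≠ a := fun t ht => by
    have := hC t
    rw [ht, sub_self, norm_zero] at this
    exact hr.ne this
  have hCb : ∀ t, C t ≠ b := fun t ht => by
    have := hC t
    rw [ht] at this
    simp only [r] at this
    linarith
  have hgc : Continuous fun t => f (C t) := continuous_iff_continuousAt.2 fun t =>
    (hfc _ (hCa t) (hCb t)).comp (f := C) C.continuous.continuousAt
  obtain ⟨k, hk⟩ := exists_logInc_eq_of_closed hgc (fun t => hf0 _) (by simp)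
  have h1 := logInc_zpow hgc (fun t => hf0 _) m
  simp only [hfm _ (hCa _) (hCb _)] at h1
  rw [logInc_div (by fun_prop) (fun t => sub_ne_zero.2 (hCb t)) (by fun_prop)
    (fun t => sub_ne_zero.2 (hCa t)), hk] at h1
  have h2 : logInc (fun t => C t - a) = _ := logIncAt_circlePath a hr
  have h3 : logInc (fun t => C t - b) = 0 := by
    have hs : ∀ t, 1 + (C t - a) / (a - b) ∈ Complex.slitPlane := by
      intro t
      refine Complex.mem_slitPlane_of_norm_lt_one ?_
      rw [norm_div, hC, norm_sub_rev a b, div_lt_one hba]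
      simp only [r]
      linarith
    have hab : a - b ≠ 0 := sub_ne_zero.2 h.ne
    have hc : Continuous fun t => 1 + (C t - a) / (a - b) := by fun_prop
    have h4 := logInc_comp_slitPlane hc hs
    have h5 := logInc_mul hc (fun t => Complex.slitPlane_ne_zero (hs t))
      (continuous_const (y := a - b)) fun t => hab
    have h6 := logInc_eq (g := fun _ => a - b) (continuous_const (y := Complex.log (a - b)))
      fun t => by rw [Complex.exp_log hab]
    rw [h4, h6] at h5
    convert h5 using 1
    · congr 1
      ext t
      field_simp
      ring
    · simp
  rw [h2, h3] at h1
  have h4 : ((m * k + 1 : ℤ) : ℂ) * (2 * Real.pi * Complex.I) = 0 := by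
    push_cast
    linear_combination -h1
  rw [mul_eq_zero, or_iff_left two_pi_I_ne_zero'] at h4
  have h5 : m * k + 1 = 0 := by exact_mod_cast h4
  exact hm (IsUnit.of_mul_eq_one (-k) (by linarith))

/-- Logarithms on the two pieces are matched at `b`; that the total increment is zero says exactly
that they then also match at `a`. -/
theorem hasLogOn_of_logInc_eq_zero (h : IsJordanPair A B) {f : ℂ → ℂ}
    (hf : ContinuousOn f (Set.range (A.trans B))) (h0 : ∀ z ∈ Set.range (A.trans B), f z ≠ 0)
    (hinc : logInc (fun t => f (A.trans B t)) = 0) : HasLogOn f (Set.range (A.trans B)) := by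
  rw [Path.trans_range] at *
  have hfA : ContinuousOn f (Set.range A) := hf.mono Set.subset_union_left
  have hfB : ContinuousOn f (Set.range B) := hf.mono Set.subset_union_right
  have h0A : ∀ z ∈ Set.range A, f z ≠ 0 := fun z hz => h0 z (Or.inl hz)
  have h0B : ∀ z ∈ Set.range B, f z ≠ 0 := fun z hz => h0 z (Or.inr hz)
  obtain ⟨L, hL, hL'⟩ := LogTrivial.range A.continuous h.injective f hfA h0A
  obtain ⟨M, hM, hM'⟩ := h.logTrivial f hfB h0B
  rw [logInc_trans A B (hfA.comp_continuous A.continuous fun t => ⟨t, rfl⟩)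
    (hfB.comp_continuous B.continuous fun t => ⟨t, rfl⟩) (fun t => h0A _ ⟨t, rfl⟩)
    (fun t => h0B _ ⟨t, rfl⟩), HasLogOn.logInc_eq hL hL' A subset_rfl,
    HasLogOn.logInc_eq hM hM' B subset_rfl] at hinc
  have hbA : b ∈ Set.range A := ⟨1, A.target⟩
  have hbB : b ∈ Set.range B := ⟨0, B.source⟩
  refine HasLogOn.of_eq_on_inter A.isClosed_range B.isClosed_range
    (M := fun z => M z + (L b - M b)) hL (by fun_prop) hL' (fun z hz => ?_) (fun z hz => ?_)
  · rw [Complex.exp_add, Complex.exp_sub, ← hL' b hbA, ← hM' b hbB, div_self (h0A b hbA),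
      mul_one, hM' z hz]
  · rcases h.inter_subset hz with rfl | rfl
    · linear_combination -hinc
    · ring

/-- For `p` of winding number zero, `z - p` has a logarithm on the curve, so the component of `p`
cannot be bounded. There is only one unbounded component. -/
theorem isPreconnected_outside (h : IsJordanPair A B) : IsPreconnected (A.trans B).outside := by
  have hK : IsCompact (Set.range (A.trans B)) := isCompact_range (A.trans B).continuous
  have hunb : ∀ p ∈ (A.trans B).outside,
      ¬ Bornology.IsBounded (connectedComponentIn (Set.range (A.trans B))ᶜ p) := by
    intro p hp hb
    have hpz : ∀ z ∈ Set.range (A.trans B), z - p ≠ 0 :=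
      fun z hz h0 => hp.1 (by rwa [← sub_eq_zero.1 h0])
    obtain ⟨L, hL, hL'⟩ := h.hasLogOn_of_logInc_eq_zero (f := fun z => z - p) (by fun_prop) hpz hp.2
    exact one_ne_zero (eq_zero_of_zpow_eq_mul_exp (n := 1) (R := fun _ => 1) hK.isClosed
      hK.isClosed.isOpen_compl.connectedComponentIn hb
      (frontier_connectedComponentIn_compl hK.isClosed p) (mem_connectedComponentIn hp.1)
      continuousOn_const (fun z _ => one_ne_zero) hL
      fun z hz => by rw [zpow_one, one_mul]; exact hL' z hz)
  refine isPreconnected_of_forall_pair fun p hp q hq =>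
    ⟨connectedComponentIn (Set.range (A.trans B))ᶜ p, fun z hz => ?_,
      mem_connectedComponentIn hp.1, ?_, isPreconnected_connectedComponentIn⟩
  · have hsub := connectedComponentIn_subset (Set.range (A.trans B))ᶜ p
    refine ⟨hsub hz, ?_⟩
    rw [(A.trans B).logIncAt_eq_of_isPreconnected isPreconnected_connectedComponentIn
      (Set.disjoint_left.2 hsub) hz (mem_connectedComponentIn hp.1)]
    exact hp.2
  · rw [connectedComponentIn_eq_of_not_isBounded hK (hunb p hp) (hunb q hq)]
    exact mem_connectedComponentIn hq.1

/-- If `p` and `q` have winding numbers `k` and `l`, then `(z - p) ^ l / (z - q) ^ k` has increment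
zero and so a logarithm on the curve. If `p` and `q` were in different components, the component of
`p` would be a bounded set on which this forces `l = 0`. -/
theorem isPreconnected_inside (h : IsJordanPair A B) : IsPreconnected (A.trans B).inside := by
  have hK : IsCompact (Set.range (A.trans B)) := isCompact_range (A.trans B).continuous
  have hsub := connectedComponentIn_subset (Set.range (A.trans B))ᶜ
  have hcomp : ∀ p ∈ (A.trans B).inside,
      connectedComponentIn (Set.range (A.trans B))ᶜ p ⊆ (A.trans B).inside := by
    refine fun p hp z hz => ⟨hsub p hz, ?_⟩
    rw [(A.trans B).logIncAt_eq_of_isPreconnected isPreconnected_connectedComponentIn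
      (Set.disjoint_left.2 (hsub p)) hz (mem_connectedComponentIn hp.1)]
    exact hp.2
  refine isPreconnected_of_forall_pair fun p hp q hq =>
    ⟨connectedComponentIn (Set.range (A.trans B))ᶜ p, hcomp p hp,
      mem_connectedComponentIn hp.1, ?_, isPreconnected_connectedComponentIn⟩
  by_contra hne
  have hpz : ∀ z ∈ Set.range (A.trans B), z - p ≠ 0 :=
    fun z hz h0 => hp.1 (by rwa [← sub_eq_zero.1 h0])
  have hqz : ∀ z ∈ Set.range (A.trans B), z - q ≠ 0 :=
    fun z hz h0 => hq.1 (by rwa [← sub_eq_zero.1 h0])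
  obtain ⟨k, hk⟩ := (A.trans B).exists_logIncAt_eq hp.1
  obtain ⟨l, hl⟩ := (A.trans B).exists_logIncAt_eq hq.1
  have hpc := (A.trans B).sub_ne_zero_of_notMem_range hp.1
  have hqc := (A.trans B).sub_ne_zero_of_notMem_range hq.1
  have hzc : ∀ (m : ℤ) (p : ℂ) (S : Set ℂ), (∀ z ∈ S, z - p ≠ 0) →
      ContinuousOn (fun z => (z - p) ^ m) S := fun m p S hS =>
    ContinuousOn.zpow₀ (by fun_prop) m fun z hz => Or.inl (hS z hz)
  have hzc' : ∀ (m : ℤ) (p : ℂ), (∀ t, A.trans B t - p ≠ 0) →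
      Continuous (fun t => (A.trans B t - p) ^ m) := fun m p hS =>
    Continuous.zpow₀ (by fun_prop) m fun t => Or.inl (hS t)
  obtain ⟨L, hL, hL'⟩ := h.hasLogOn_of_logInc_eq_zero (f := fun z => (z - p) ^ l / (z - q) ^ k)
    ((hzc l p _ hpz).div (hzc k q _ hqz) fun z hz => zpow_ne_zero _ (hqz z hz))
    (fun z hz => div_ne_zero (zpow_ne_zero _ (hpz z hz)) (zpow_ne_zero _ (hqz z hz))) (by
      rw [logInc_div (hzc' l p hpc) (fun t => zpow_ne_zero _ (hpc t)) (hzc' k q hqc)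
        (fun t => zpow_ne_zero _ (hqc t)), logInc_zpow (by fun_prop) hpc,
        logInc_zpow (by fun_prop) hqc]
      rw [Path.logIncAt] at hk hl
      rw [hk, hl]
      ring)
  have hl0 := eq_zero_of_zpow_eq_mul_exp (n := l) (R := fun z => (z - q) ^ k) hK.isClosed
      hK.isClosed.isOpen_compl.connectedComponentIn ((A.trans B).isBounded_inside.subset (hcomp p hp))
      (frontier_connectedComponentIn_compl hK.isClosed p) (mem_connectedComponentIn hp.1)
      (hzc k q _ ?_) (fun z hz => zpow_ne_zero _ ?_) hL
      fun z hz => by rw [← hL' z hz, mul_div_cancel₀ _ (zpow_ne_zero _ (hqz z hz))]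
  · refine hq.2 ?_
    rw [hl, hl0]
    simp
  · intro z hz h0
    rw [sub_eq_zero.1 h0] at hz
    exact notMem_closure_connectedComponentIn hK.isClosed hq.1
      (fun heq => hne (heq ▸ mem_connectedComponentIn hq.1)) hz
  · intro h0
    rw [sub_eq_zero.1 h0] at hz
    exact notMem_closure_connectedComponentIn hK.isClosed hq.1
      (fun heq => hne (heq ▸ mem_connectedComponentIn hq.1)) hz

theorem inside_nonempty (h : IsJordanPair A B) : (A.trans B).inside.Nonempty := by
  obtain ⟨z, hz, hz'⟩ := h.exists_logIncAt_not_dvd two_ne_zero (by decide)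
  exact ⟨z, hz, fun h0 => hz' 0 (by rw [h0]; simp)⟩

theorem exists_logIncAt_eq_unit (h : IsJordanPair A B) : ∃ s : ℤ, (s = 1 ∨ s = -1) ∧
    ∀ z ∈ (A.trans B).inside, (A.trans B).logIncAt z = s * (2 * Real.pi * Complex.I) := by
  obtain ⟨p, hp⟩ := h.inside_nonempty
  obtain ⟨s, hs⟩ := (A.trans B).exists_logIncAt_eq hp.1
  have hconst : ∀ z ∈ (A.trans B).inside,
      (A.trans B).logIncAt z = s * (2 * Real.pi * Complex.I) := fun z hz => by
    rw [← hs, (A.trans B).logIncAt_eq_of_isPreconnected h.isPreconnected_inside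
      (Set.disjoint_left.2 fun _ h => h.1) hz hp]
  refine ⟨s, ?_, hconst⟩
  by_contra hunit
  -- The winding number is constantly `s` inside and 0 outside, so all winding numbers are divisible
  -- by `s`; hence `s` is a unit.
  obtain ⟨z, hz, hz'⟩ := h.exists_logIncAt_not_dvd (m := s)
    (by rintro rfl; exact hp.2 (by rw [hs]; simp)) (fun hu => hunit (Int.isUnit_iff.1 hu))
  refine hz' 1 ?_
  rw [mul_one]
  exact hconst z ⟨hz, fun h0 => hz' 0 (by rw [h0]; simp)⟩

/-- If the closure of `U` missed `A t₀`, it would miss a whole subarc around it. The rest of the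
curve carries no cohomology, so its complement is connected. In that complement `U` is open and
closed, so `U` fills it and contains `A t₀`. -/
theorem mem_closure_of_frontier_subset (h : IsJordanPair A B) {U : Set ℂ} (hU : IsOpen U)
    (hne : U.Nonempty) (hUJ : Disjoint U (Set.range (A.trans B)))
    (hfr : closure U ⊆ U ∪ Set.range (A.trans B)) {t₀ : I} (h0 : t₀ ≠ 0) (h1 : t₀ ≠ 1) :
    A t₀ ∈ closure U := by
  by_contra hcl
  have hnhds : A ⁻¹' (closure U)ᶜ ∈ nhds t₀ :=
    (isClosed_closure.isOpen_compl.preimage A.continuous).mem_nhds hcl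
  have h0' : 0 < t₀ := unitInterval.pos_iff_ne_zero.2 h0
  have h1' : t₀ < 1 := unitInterval.lt_one_iff_ne_one.2 h1
  obtain ⟨s, hs, hs'⟩ := exists_Ioc_subset_of_mem_nhds hnhds ⟨0, h0'⟩
  obtain ⟨t, ht, ht'⟩ := exists_Ico_subset_of_mem_nhds hnhds ⟨1, h1'⟩
  have h0s : 0 ≤ s := unitInterval.nonneg'
  have ht1 : t ≤ 1 := unitInterval.le_one'
  have hinter : ∀ τ, A τ ∈ Set.range B → τ = 0 ∨ τ = 1 := by
    intro τ hτ
    rcases h.inter_subset ⟨⟨τ, rfl⟩, hτ⟩ with h' | h'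
    · exact Or.inl (h.injective (h'.trans A.source.symm))
    · exact Or.inr (h.injective (h'.trans A.target.symm))
  have hcs : IsClosed (A '' Set.Icc 0 s) := (isCompact_Icc.image A.continuous).isClosed
  have hct : IsClosed (A '' Set.Icc t 1) := (isCompact_Icc.image A.continuous).isClosed
  have hT1 : LogTrivial (A '' Set.Icc 0 s ∪ Set.range B) := by
    refine (LogTrivial.image A.continuous h.injective h0s).union h.logTrivial hcs B.isClosed_range
      (a := a) ⟨⟨0, ⟨le_rfl, h0s⟩, A.source⟩, ⟨1, B.target⟩⟩ ?_
    rintro _ ⟨⟨τ, hτ, rfl⟩, hB⟩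
    rcases hinter τ hB with rfl | rfl
    · exact A.source
    · exact absurd (hτ.2.trans_lt (hs.trans h1')) (lt_irrefl _)
  have hT2 : LogTrivial (A '' Set.Icc 0 s ∪ Set.range B ∪ A '' Set.Icc t 1) := by
    refine hT1.union (LogTrivial.image A.continuous h.injective ht1) (hcs.union B.isClosed_range) hct
      (a := b) ⟨Or.inr ⟨0, B.source⟩, ⟨1, ⟨ht1, le_rfl⟩, A.target⟩⟩ ?_
    rintro _ ⟨hz, ⟨τ, hτ, rfl⟩⟩
    rcases hz with ⟨τ', hτ', heq⟩ | hB
    · have := h.injective heq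
      subst this
      exact absurd (hτ'.2.trans_lt (hs.trans ht)) (not_lt.2 hτ.1)
    · rcases hinter τ hB with rfl | rfl
      · exact absurd (h0'.trans ht) (not_lt.2 hτ.1)
      · exact A.target
  have hsubJ : A '' Set.Icc 0 s ∪ Set.range B ∪ A '' Set.Icc t 1 ⊆ Set.range (A.trans B) := by
    rw [Path.trans_range]
    rintro z ((⟨τ, -, rfl⟩ | hz) | ⟨τ, -, rfl⟩)
    exacts [Or.inl ⟨τ, rfl⟩, Or.inr hz, Or.inl ⟨τ, rfl⟩]
  have hcov : ∀ z ∈ closure U, z ∈ Set.range (A.trans B) →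
      z ∈ A '' Set.Icc 0 s ∪ Set.range B ∪ A '' Set.Icc t 1 := by
    intro z hz hzJ
    rw [Path.trans_range] at hzJ
    rcases hzJ with ⟨τ, rfl⟩ | hzB
    · rcases le_or_gt τ s with hτ | hτ
      · exact Or.inl (Or.inl ⟨τ, ⟨unitInterval.nonneg', hτ⟩, rfl⟩)
      · rcases le_or_gt t τ with hτ' | hτ'
        · exact Or.inr ⟨τ, ⟨hτ', unitInterval.le_one'⟩, rfl⟩
        · exfalso
          rcases le_or_gt τ t₀ with h3 | h3
          · exact hs' ⟨hτ, h3⟩ hz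
          · exact ht' ⟨h3.le, hτ'⟩ hz
    · exact Or.inl (Or.inr hzB)
  have hcomp : IsCompact (A '' Set.Icc 0 s ∪ Set.range B ∪ A '' Set.Icc t 1) :=
    ((isCompact_Icc.image A.continuous).union (isCompact_range B.continuous)).union
      (isCompact_Icc.image A.continuous)
  have hsub : (A '' Set.Icc 0 s ∪ Set.range B ∪ A '' Set.Icc t 1)ᶜ ⊆ U := by
    refine (hT2.isPreconnected_compl hcomp).subset_of_closure_inter_subset hU ?_ ?_
    · obtain ⟨z, hz⟩ := hne
      exact ⟨z, fun hz' => hUJ.le_bot ⟨hz, hsubJ hz'⟩, hz⟩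
    · rintro z ⟨hz, hz'⟩
      exact (hfr hz).resolve_right fun hJ => hz' (hcov z hz hJ)
  refine hcl (subset_closure (hsub ?_))
  rintro ((⟨τ, hτ, heq⟩ | hB) | ⟨τ, hτ, heq⟩)
  · rw [h.injective heq] at hτ
    exact hτ.2.not_gt hs
  · rcases hinter _ hB with h' | h'
    exacts [h0 h', h1 h']
  · rw [h.injective heq] at hτ
    exact hτ.1.not_gt ht

theorem mem_closure_inside (h : IsJordanPair A B) {t : I} (h0 : t ≠ 0) (h1 : t ≠ 1) :
    A t ∈ closure (A.trans B).inside :=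
  h.mem_closure_of_frontier_subset (A.trans B).isOpen_inside h.inside_nonempty
    (Set.disjoint_left.2 fun _ hz => hz.1) (A.trans B).closure_inside_subset h0 h1

theorem mem_closure_outside (h : IsJordanPair A B) {t : I} (h0 : t ≠ 0) (h1 : t ≠ 1) :
    A t ∈ closure (A.trans B).outside := by
  refine h.mem_closure_of_frontier_subset (A.trans B).isOpen_outside ?_
    (Set.disjoint_left.2 fun _ hz => hz.1) (A.trans B).closure_outside_subset h0 h1
  obtain ⟨r, hr0, hr⟩ := (A.trans B).exists_forall_mem_outside
  refine ⟨((r + 1 : ℝ) : ℂ), hr _ ?_⟩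
  rw [Complex.norm_real, Real.norm_of_nonneg (by linarith)]
  linarith

end IsJordanPair

/-! ### Sums along walks -/

namespace SimpleGraph

variable {V : Type*} {G : SimpleGraph V} {A : Type*} [AddCommGroup A]

namespace Walk

/-- The sum of the weights of the darts of a walk. -/
def dartSum (w : V → V → A) {u v : V} (p : G.Walk u v) : A :=
  (p.darts.map fun d => w d.fst d.snd).sum

variable {w : V → V → A} {u v x : V}

@[simp]
theorem dartSum_nil : (nil : G.Walk u u).dartSum w = 0 := rfl

@[simp]
theorem dartSum_cons (h : G.Adj u v) (p : G.Walk v x) :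
    (cons h p).dartSum w = w u v + p.dartSum w := by
  simp [dartSum]

@[simp]
theorem dartSum_append (p : G.Walk u v) (q : G.Walk v x) :
    (p.append q).dartSum w = p.dartSum w + q.dartSum w := by
  simp [dartSum]

theorem dartSum_sub (w' : V → V → A) (p : G.Walk u v) :
    p.dartSum (fun x y => w x y - w' x y) = p.dartSum w - p.dartSum w' := by
  induction p with
  | nil => simp
  | cons h p ih =>
    simp only [dartSum_cons, ih]
    abel

theorem dartSum_reverse (hw : ∀ u v, G.Adj u v → w v u = -w u v) (p : G.Walk u v) :
    p.reverse.dartSum w = -p.dartSum w := by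
  induction p with
  | nil => simp
  | cons h p ih =>
    rw [reverse_cons, dartSum_append, ih, dartSum_cons, dartSum_cons, dartSum_nil, hw _ _ h]
    abel

theorem dartSum_mapLe {H : SimpleGraph V} (h : H ≤ G) (p : H.Walk u v) :
    (p.mapLe h).dartSum w = p.dartSum w := by
  induction p with
  | nil => rfl
  | cons h' p ih =>
    change (cons (h h') (p.mapLe h)).dartSum w = _
    rw [dartSum_cons, dartSum_cons, ih]

theorem dartSum_rotate [DecidableEq V] (c : G.Walk u u) (h : x ∈ c.support) :
    (c.rotate x h).dartSum w = c.dartSum w := by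
  conv_rhs => rw [← c.take_spec h]
  rw [rotate, dartSum_append, dartSum_append, add_comm]

/-- Each detour that is cut out is a cycle or runs back and forth along one edge; it contributes
zero by `hc` or by antisymmetry. -/
theorem dartSum_bypass [DecidableEq V] (hw : ∀ u v, G.Adj u v → w v u = -w u v)
    (hc : ∀ (u : V) (c : G.Walk u u), c.IsCycle → c.dartSum w = 0) (p : G.Walk u v) :
    p.bypass.dartSum w = p.dartSum w := by
  induction p with
  | nil => rfl
  | @cons u v x h p ih =>
    rw [dartSum_cons, ← ih, bypass]
    split_ifs with hs
    · have hspec := congrArg (dartSum w) (p.bypass.take_spec hs)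
      rw [dartSum_append] at hspec
      have hpath := p.bypass_isPath.takeUntil hs
      have hzero : w u v + (p.bypass.takeUntil u hs).dartSum w = 0 := by
        by_cases he : s(u, v) ∈ (p.bypass.takeUntil u hs).edges
        · have hlen := hpath.length_eq_one_of_mem_edges (Sym2.eq_swap ▸ he)
          generalize p.bypass.takeUntil u hs = q at hlen
          match q, hlen with
          | cons h' nil, _ => simp [hw _ _ h]
        · have := hc u _ ((cons_isCycle_iff _ h).2 ⟨hpath, he⟩)
          rwa [dartSum_cons] at this
      rw [← hspec, ← add_assoc, hzero, zero_add]
    · rw [dartSum_cons]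

theorem dartSum_eq_zero_of_forall_isCycle (hw : ∀ u v, G.Adj u v → w v u = -w u v)
    (hc : ∀ (u : V) (c : G.Walk u u), c.IsCycle → c.dartSum w = 0) (c : G.Walk u u) :
    c.dartSum w = 0 := by
  classical
  rw [← dartSum_bypass hw hc, isPath_iff_nil.1 c.bypass_isPath |>.eq_nil, dartSum_nil]

end Walk

/-- A weight on darts that sums to zero on closed walks is a difference of vertex weights, and these
may be required to satisfy a condition that is propagated along edges. -/
theorem exists_potential {w : V → V → A} (hc : ∀ (u : V) (c : G.Walk u u), c.dartSum w = 0)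
    (hw : ∀ u v, G.Adj u v → w v u = -w u v) {P : V → A → Prop} (hP : ∀ v, ∃ a, P v a)
    (hstep : ∀ u v a, G.Adj u v → P u a → P v (a + w u v)) :
    ∃ φ : V → A, (∀ v, P v (φ v)) ∧ ∀ u v, G.Adj u v → w u v = φ v - φ u := by
  choose g hg using hP
  -- A root in each component; the potential at `v` is the sum along a walk from the root, starting
  -- from an admissible value there.
  let r : V → V := fun v => (G.connectedComponentMk v).out
  have hr : ∀ v, G.Reachable (r v) v := fun v => ConnectedComponent.exact (Quot.out_eq _)
  let q : ∀ v, G.Walk (r v) v := fun v => (hr v).some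
  have hwalk : ∀ {u v : V} (p : G.Walk u v) (a : A), P u a → P v (a + p.dartSum w) := by
    intro u v p
    induction p with
    | nil => intro a ha; simpa using ha
    | cons h p ih =>
      intro a ha
      rw [Walk.dartSum_cons, ← add_assoc]
      exact ih _ (hstep _ _ _ h ha)
  refine ⟨fun v => g (r v) + (q v).dartSum w, fun v => hwalk _ _ (hg _), fun u v h => ?_⟩
  have hruv : r u = r v := congrArg Quot.out (ConnectedComponent.sound h.reachable)
  have key : ∀ (a b : V) (p : G.Walk a u) (p' : G.Walk b v), a = b →
      w u v = g b + p'.dartSum w - (g a + p.dartSum w) := by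
    rintro a _ p p' rfl
    have := hc a ((p.append (Walk.cons h Walk.nil)).append p'.reverse)
    rw [Walk.dartSum_append, Walk.dartSum_append, Walk.dartSum_reverse hw, Walk.dartSum_cons,
      Walk.dartSum_nil, add_zero, ← sub_eq_add_neg, sub_eq_zero] at this
    rw [← this]
    abel
  exact key _ _ _ _ hruv

/-! ### Chords of cycles -/

namespace Walk

variable {u x y : V}

theorem IsCycle.append_comm {p : G.Walk x y} {q : G.Walk y x} (h : (p.append q).IsCycle) :
    (q.append p).IsCycle := by
  rw [isCycle_def, isTrail_def, tail_support_append, edges_append] at *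
  refine ⟨List.perm_append_comm.nodup_iff.1 h.1, fun hnil => h.2.1 ?_,
    List.perm_append_comm.nodup_iff.1 h.2.2⟩
  have h1 : (q.append p).length = 0 := by rw [hnil]; rfl
  rw [length_append] at h1
  have h2 : (p.append q).length = 0 := by rw [length_append]; omega
  exact (length_eq_zero_iff.1 h2).eq_nil

theorem exists_append_cons_of_mem_darts {v : V} {p : G.Walk u v} {d : G.Dart}
    (hd : d ∈ p.darts) : ∃ (q : G.Walk u d.fst) (r : G.Walk d.snd v),
      p = q.append (cons d.adj r) := by
  induction p with
  | nil => simp at hd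
  | cons h p ih =>
    rw [darts_cons, List.mem_cons] at hd
    rcases hd with rfl | hd
    · exact ⟨nil, p, rfl⟩
    · obtain ⟨q, r, rfl⟩ := ih hd
      exact ⟨cons h q, r, rfl⟩

/-- The edge condition `hH` excludes the degenerate case in which both paths are the same single
edge. -/
theorem isCycle_append_reverse_mapLe {H : SimpleGraph V} (hle : H ≤ G) {q : G.Walk x y}
    {p : H.Walk x y} (hq : q.IsPath) (hp : p.IsPath) (hxy : x ≠ y)
    (hH : ∀ e ∈ q.edges, e ∉ H.edgeSet)
    (hs : ∀ z ∈ q.support, z ∈ p.support → z = x ∨ z = y) :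
    (q.append (p.mapLe hle).reverse).IsCycle := by
  have hp' : (p.mapLe hle).reverse.IsPath := (hp.mapLe hle).reverse
  refine hq.isCycle_append hp' (fun z hz hz' => ?_) ?_
  · have h1 : z ∈ q.support := List.mem_of_mem_tail hz
    have h2 : z ∈ p.support := by
      have := List.mem_of_mem_tail hz'
      rwa [support_reverse, List.mem_reverse, support_mapLe_eq_support] at this
    rcases hs z h1 h2 with rfl | rfl
    · have := hq.support_nodup
      rw [← cons_tail_support, List.nodup_cons] at this
      exact this.1 hz
    · have := hp'.support_nodup
      rw [← cons_tail_support, List.nodup_cons] at this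
      exact this.1 hz'
  · by_contra! hlen
    rw [length_reverse, length_map] at hlen
    match q, p, hlen with
    | nil, _, _ => exact hxy rfl
    | cons h nil, nil, _ => exact hxy rfl
    | cons h nil, cons h' nil, _ => exact hH s(x, y) (by simp) h'
    | cons _ (cons _ _), _, hlen => simp at hlen
    | _, cons _ (cons _ _), hlen => simp at hlen

/-- A cycle with a chord in `H` is the sum of two cycles. -/
theorem IsCycle.exists_of_reachable {c : G.Walk u u} (hc : c.IsCycle) {H : SimpleGraph V}
    (hle : H ≤ G) (hH : ∀ e ∈ c.edges, e ∉ H.edgeSet) (hx : x ∈ c.support) (hy : y ∈ c.support)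
    (hxy : x ≠ y) (hreach : H.Reachable x y) :
    ∃ (z : V) (c₁ c₂ : G.Walk z z), c₁.IsCycle ∧ c₂.IsCycle ∧
      (∀ e ∈ c₁.edges, e ∈ c.edges ∨ e ∈ H.edgeSet) ∧
      (∀ e ∈ c₂.edges, e ∈ c.edges ∨ e ∈ H.edgeSet) ∧
      (∃ e ∈ c.edges, e ∉ c₁.edges) ∧ (∃ e ∈ c.edges, e ∉ c₂.edges) ∧
      ∀ w : V → V → A, (∀ u v, G.Adj u v → w v u = -w u v) →
        c₁.dartSum w = 0 → c₂.dartSum w = 0 → c.dartSum w = 0 := by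
  classical
  -- Take a shortest `H`-walk between any two distinct vertices of the cycle: by minimality it meets
  -- the cycle only at its ends.
  have hex : ∃ n, ∃ x ∈ c.support, ∃ y ∈ c.support, x ≠ y ∧ ∃ p : H.Walk x y, p.length = n := by
    obtain ⟨p⟩ := hreach
    exact ⟨_, x, hx, y, hy, hxy, p, rfl⟩
  clear hx hy hxy hreach
  obtain ⟨x, hx, y, hy, hxy, p, hp⟩ := Nat.find_spec hex
  have hmin : ∀ {x' y' : V} (q : H.Walk x' y'), x' ∈ c.support → y' ∈ c.support → x' ≠ y' →
      p.length ≤ q.length := fun q hx' hy' hne =>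
    hp ▸ Nat.find_min' hex ⟨_, hx', _, hy', hne, q, rfl⟩
  clear hp
  have hs : ∀ z ∈ c.support, z ∈ p.bypass.support → z = x ∨ z = y := by
    intro z hz hzp
    obtain ⟨q, r, hqr⟩ := mem_support_iff_exists_append.1 hzp
    by_contra! hne
    have h1 := hmin q hx hz hne.1.symm
    have h2 := congrArg length hqr
    rw [length_append] at h2
    have h3 := p.length_bypass_le_length
    have h4 : r.length = 0 := by omega
    exact hne.2 (eq_of_length_eq_zero h4)
  have hpath := p.bypass_isPath
  set p' := p.bypass
  have hc' : (c.rotate x hx).IsCycle := hc.rotate hx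
  have hedges : ∀ e, e ∈ (c.rotate x hx).edges ↔ e ∈ c.edges :=
    fun e => (c.rotate_edges x hx).mem_iff
  have hsupp : ∀ z, z ∈ (c.rotate x hx).support ↔ z ∈ c.support := by
    intro z
    rw [rotate, mem_support_append_iff, or_comm, ← mem_support_append_iff, take_spec]
  have hsum := fun w : V → V → A => dartSum_rotate (w := w) c hx
  obtain ⟨q₁, q₂, hq⟩ := mem_support_iff_exists_append.1 ((hsupp y).2 hy)
  rw [hq] at hc' hedges hsupp hsum
  have hq₁ : q₁.IsPath := hc'.isPath_of_append_left (not_nil_of_ne hxy.symm)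
  have hq₂ : q₂.IsPath := hc'.isPath_of_append_right (not_nil_of_ne hxy)
  have hnodup := hc'.isTrail.edges_nodup
  rw [edges_append, List.nodup_append'] at hnodup
  have he₁ : ∀ e ∈ q₁.edges, e ∈ c.edges := fun e he => (hedges e).1 (by simp [he])
  have he₂ : ∀ e ∈ q₂.edges, e ∈ c.edges := fun e he => (hedges e).1 (by simp [he])
  have hpH : ∀ e ∈ p'.edges, e ∈ H.edgeSet := fun e he => p'.edges_subset_edgeSet he
  have hexe : ∀ {a b : V} (q : G.Walk a b), a ≠ b → ∃ e, e ∈ q.edges := fun q hne =>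
    List.exists_mem_of_ne_nil _ fun h => not_nil_of_ne hne (edges_eq_nil.1 h)
  -- The endpoints cut the cycle into `q₁` and `q₂`, and each is closed up by the chord. The sum
  -- along `c` is that of the first cycle minus that of the second, since `q₂` is traversed
  -- backwards.
  refine ⟨x, q₁.append (p'.mapLe hle).reverse, q₂.reverse.append (p'.mapLe hle).reverse,
    isCycle_append_reverse_mapLe hle hq₁ hpath hxy (fun e he => hH e (he₁ e he))
      (fun z hz => hs z ((hsupp z).1 (by simp [hz]))),
    isCycle_append_reverse_mapLe hle hq₂.reverse hpath hxy
      (fun e he => hH e (he₂ e (by simpa using he)))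
      (fun z hz => hs z ((hsupp z).1 (by
        rw [support_reverse, List.mem_reverse] at hz
        simp [hz]))), ?_, ?_, ?_, ?_, ?_⟩
  · intro e he
    rw [edges_append, List.mem_append, edges_reverse, List.mem_reverse,
      edges_mapLe_eq_edges] at he
    exact he.imp (he₁ e) (hpH e)
  · intro e he
    rw [edges_append, List.mem_append, edges_reverse, List.mem_reverse, edges_reverse,
      List.mem_reverse, edges_mapLe_eq_edges] at he
    exact he.imp (he₂ e) (hpH e)
  · obtain ⟨e, he⟩ := hexe q₂ hxy.symm
    refine ⟨e, he₂ e he, fun h => ?_⟩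
    rw [edges_append, List.mem_append, edges_reverse, List.mem_reverse,
      edges_mapLe_eq_edges] at h
    rcases h with h | h
    · exact hnodup.2.2 h he
    · exact hH e (he₂ e he) (hpH e h)
  · obtain ⟨e, he⟩ := hexe q₁ hxy
    refine ⟨e, he₁ e he, fun h => ?_⟩
    rw [edges_append, List.mem_append, edges_reverse, List.mem_reverse, edges_reverse,
      List.mem_reverse, edges_mapLe_eq_edges] at h
    rcases h with h | h
    · exact hnodup.2.2 he h
    · exact hH e (he₁ e he) (hpH e h)
  · intro w hw h1 h2
    rw [dartSum_append, dartSum_reverse hw] at h1 h2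
    rw [dartSum_reverse hw] at h2
    rw [← hsum w, dartSum_append, add_neg_eq_zero.1 h1, ← neg_eq_zero, ← h2]
    abel

end Walk

end SimpleGraph

/-! ### Plane graphs -/

namespace PlaneEmbedding

variable {V : Type*} {G : SimpleGraph V} (E : PlaneEmbedding G) {u v x y : V}

/-- The arc of an edge. -/
def edgeArc (e : Sym2 V) : Set ℂ :=
  {z | ∃ (u v : V) (h : G.Adj u v), s(u, v) = e ∧ z ∈ Set.range (E.arc h)}

/-- The arc of an edge without its endpoints. -/
def openArc (e : Sym2 V) : Set ℂ := E.edgeArc e \ Set.range E.pt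

theorem edgeArc_mk (h : G.Adj u v) : E.edgeArc s(u, v) = Set.range (E.arc h) := by
  ext z
  constructor
  · rintro ⟨u', v', h', he, hz⟩
    rcases Sym2.eq_iff.1 he with ⟨rfl, rfl⟩ | ⟨rfl, rfl⟩
    · exact hz
    · rwa [E.arc_symm h, Path.symm_range] at hz
  · exact fun hz => ⟨u, v, h, rfl, hz⟩

theorem edgeArc_eq_empty {e : Sym2 V} (he : e ∉ G.edgeSet) : E.edgeArc e = ∅ :=
  Set.eq_empty_of_forall_notMem fun _ ⟨_, _, h, he', _⟩ => he (he' ▸ h)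

theorem isCompact_edgeArc (e : Sym2 V) : IsCompact (E.edgeArc e) := by
  by_cases he : e ∈ G.edgeSet
  · induction e with
    | _ u v =>
      rw [E.edgeArc_mk he]
      exact isCompact_range (E.arc he).continuous
  · rw [E.edgeArc_eq_empty he]
    exact isCompact_empty

theorem pt_mem_edgeArc (h : G.Adj u v) : E.pt u ∈ E.edgeArc s(u, v) := by
  rw [E.edgeArc_mk h]
  exact ⟨0, (E.arc h).source⟩

theorem mem_of_pt_mem_edgeArc {e : Sym2 V} (h : E.pt x ∈ E.edgeArc e) : x ∈ e := by
  obtain ⟨u, v, h, rfl, t, ht⟩ := h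
  rcases E.arc_ne_pt h t x ht with rfl | rfl
  · rw [Path.source] at ht
    rw [E.pt_injective ht]
    exact Sym2.mem_mk_left _ _
  · rw [Path.target] at ht
    rw [E.pt_injective ht]
    exact Sym2.mem_mk_right _ _

theorem eq_of_mem_openArc {e e' : Sym2 V} {z : ℂ} (h : z ∈ E.openArc e) (h' : z ∈ E.edgeArc e') :
    e' = e := by
  obtain ⟨⟨u, v, h, rfl, t, rfl⟩, hz⟩ := h
  obtain ⟨u', v', h', rfl, t', ht⟩ := h'
  by_contra hne
  rcases E.arc_disjoint h h' t t' (Ne.symm hne) ht.symm with rfl | rfl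
  · exact hz ⟨u, (E.arc h).source.symm⟩
  · exact hz ⟨v, (E.arc h).target.symm⟩

theorem openArc_mk (h : G.Adj u v) : E.openArc s(u, v) = E.arc h '' Set.Ioo 0 1 := by
  rw [openArc, E.edgeArc_mk h]
  ext z
  constructor
  · rintro ⟨⟨t, rfl⟩, hz⟩
    refine ⟨t, ⟨unitInterval.pos_iff_ne_zero.2 ?_, unitInterval.lt_one_iff_ne_one.2 ?_⟩, rfl⟩
    · rintro rfl
      exact hz ⟨u, (E.arc h).source.symm⟩
    · rintro rfl
      exact hz ⟨v, (E.arc h).target.symm⟩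
  · rintro ⟨t, ht, rfl⟩
    refine ⟨⟨t, rfl⟩, ?_⟩
    rintro ⟨w, hw⟩
    rcases E.arc_ne_pt h t w hw.symm with rfl | rfl
    · exact lt_irrefl _ ht.1
    · exact lt_irrefl _ ht.2

theorem isPreconnected_openArc (h : G.Adj u v) : IsPreconnected (E.openArc s(u, v)) := by
  rw [E.openArc_mk h]
  exact isPreconnected_Ioo.image _ (E.arc h).continuous.continuousOn

theorem openArc_nonempty (h : G.Adj u v) : (E.openArc s(u, v)).Nonempty := by
  rw [E.openArc_mk h]
  exact (Set.nonempty_Ioo.2 zero_lt_one).image _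

theorem edgeArc_subset_closure_openArc (e : Sym2 V) : E.edgeArc e ⊆ closure (E.openArc e) := by
  by_cases he : e ∈ G.edgeSet
  · induction e with
    | _ u v =>
      rw [E.edgeArc_mk he, E.openArc_mk he]
      refine subset_trans ?_ (image_closure_subset_closure_image (E.arc he).continuous)
      rw [closure_Ioo zero_ne_one]
      rintro _ ⟨t, rfl⟩
      exact ⟨t, ⟨unitInterval.nonneg', unitInterval.le_one'⟩, rfl⟩
  · rw [E.edgeArc_eq_empty he]
    exact Set.empty_subset _

theorem drawing_eq : E.drawing = Set.range E.pt ∪ ⋃ e, E.edgeArc e := by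
  rw [drawing]
  congr 1
  ext z
  simp only [Set.mem_iUnion]
  constructor
  · rintro ⟨u, v, h, hz⟩
    exact ⟨s(u, v), u, v, h, rfl, hz⟩
  · rintro ⟨_, u, v, h, rfl, hz⟩
    exact ⟨u, v, h, hz⟩

theorem pt_mem_drawing (v : V) : E.pt v ∈ E.drawing := Or.inl ⟨v, rfl⟩

theorem edgeArc_subset_drawing (e : Sym2 V) : E.edgeArc e ⊆ E.drawing := by
  rw [drawing_eq]
  exact (Set.subset_iUnion _ e).trans Set.subset_union_right

theorem isCompact_drawing [Finite V] : IsCompact E.drawing := by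
  rw [drawing_eq]
  exact (Set.finite_range _).isCompact.union (isCompact_iUnion E.isCompact_edgeArc)

/-! #### Curves of walks -/

theorem mem_range_curve {p : G.Walk u v} {z : ℂ} :
    z ∈ Set.range (E.curve p) ↔ z = E.pt u ∨ ∃ e ∈ p.edges, z ∈ E.edgeArc e := by
  induction p with
  | nil => simp [curve]
  | @cons u v w h p ih =>
    rw [curve, Path.trans_range, Set.mem_union, ih, ← E.edgeArc_mk h]
    simp only [SimpleGraph.Walk.edges_cons, List.mem_cons, exists_eq_or_imp]
    have h1 := E.pt_mem_edgeArc h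
    have h2 : E.pt v ∈ E.edgeArc s(u, v) := Sym2.eq_swap ▸ E.pt_mem_edgeArc h.symm
    constructor
    · rintro (hz | rfl | hz)
      exacts [Or.inr (Or.inl hz), Or.inr (Or.inl h2), Or.inr (Or.inr hz)]
    · rintro (rfl | hz | hz)
      exacts [Or.inl h1, Or.inl hz, Or.inr (Or.inr hz)]

theorem mem_range_curve_of_not_nil {p : G.Walk u v} (hp : ¬ p.Nil) {z : ℂ} :
    z ∈ Set.range (E.curve p) ↔ ∃ e ∈ p.edges, z ∈ E.edgeArc e := by
  rw [mem_range_curve, or_iff_right_of_imp]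
  rintro rfl
  cases p with
  | nil => exact absurd SimpleGraph.Walk.Nil.nil hp
  | cons h p => exact ⟨_, by simp, E.pt_mem_edgeArc h⟩

theorem edgeArc_subset_range_curve {p : G.Walk u v} {e : Sym2 V} (he : e ∈ p.edges) :
    E.edgeArc e ⊆ Set.range (E.curve p) := fun _ hz => E.mem_range_curve.2 (Or.inr ⟨e, he, hz⟩)

theorem mem_edges_of_mem_openArc {p : G.Walk u v} {e : Sym2 V} {z : ℂ} (hz : z ∈ E.openArc e)
    (h : z ∈ Set.range (E.curve p)) : e ∈ p.edges := by
  rcases E.mem_range_curve.1 h with rfl | ⟨e', he', hz'⟩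
  · exact absurd ⟨u, rfl⟩ hz.2
  · rwa [← E.eq_of_mem_openArc hz hz']

theorem pt_mem_range_curve {p : G.Walk u v} :
    E.pt x ∈ Set.range (E.curve p) ↔ x ∈ p.support := by
  constructor
  · rw [mem_range_curve]
    rintro (h | ⟨e, he, h⟩)
    · rw [E.pt_injective h]
      exact p.start_mem_support
    · exact p.mem_support_of_mem_edges he (E.mem_of_pt_mem_edgeArc h)
  · intro h
    induction p with
    | nil =>
      rw [SimpleGraph.Walk.support_nil, List.mem_singleton] at h
      subst h
      exact ⟨0, (E.curve _).source⟩
    | cons h' p ih =>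
      rw [SimpleGraph.Walk.support_cons, List.mem_cons] at h
      rw [curve, Path.trans_range]
      rcases h with rfl | h
      · exact Or.inl ⟨0, (E.arc h').source⟩
      · exact Or.inr (ih h)

theorem range_curve_subset_drawing (p : G.Walk u v) : Set.range (E.curve p) ⊆ E.drawing := by
  intro z hz
  rcases E.mem_range_curve.1 hz with rfl | ⟨e, -, hz⟩
  · exact E.pt_mem_drawing _
  · exact E.edgeArc_subset_drawing e hz

/-- Along a path each new arc meets the curve of the remaining path in one point only, so the gluing
of logarithms applies repeatedly. -/
theorem logTrivial_range_curve {p : G.Walk u v} (hp : p.IsPath) :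
    LogTrivial (Set.range (E.curve p)) := by
  induction p with
  | nil =>
    rw [curve, Path.refl_range]
    exact LogTrivial.singleton _
  | @cons u v w h p ih =>
    rw [SimpleGraph.Walk.cons_isPath_iff] at hp
    rw [curve, Path.trans_range]
    refine (LogTrivial.range (E.arc h).continuous (E.arc_injective h)).union (ih hp.1)
      (E.arc h).isClosed_range (E.curve p).isClosed_range (a := E.pt v)
      ⟨⟨1, (E.arc h).target⟩, ⟨0, (E.curve p).source⟩⟩ ?_
    rintro z ⟨hz, hz'⟩
    rw [← E.edgeArc_mk h] at hz
    by_cases hpt : z ∈ Set.range E.pt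
    · obtain ⟨x, rfl⟩ := hpt
      rcases Sym2.mem_iff.1 (E.mem_of_pt_mem_edgeArc hz) with rfl | rfl
      · exact absurd (E.pt_mem_range_curve.1 hz') hp.2
      · rfl
    · exact absurd (p.fst_mem_support_of_mem_edges (E.mem_edges_of_mem_openArc ⟨hz, hpt⟩ hz')) hp.2

theorem isJordanPair {h : G.Adj u v} {p : G.Walk v u} (hc : (SimpleGraph.Walk.cons h p).IsCycle) :
    IsJordanPair (E.arc h) (E.curve p) := by
  rw [SimpleGraph.Walk.cons_isCycle_iff] at hc
  refine ⟨E.arc_injective h, E.logTrivial_range_curve hc.1, ?_⟩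
  rintro z ⟨hz, hz'⟩
  rw [← E.edgeArc_mk h] at hz
  by_cases hpt : z ∈ Set.range E.pt
  · obtain ⟨x, rfl⟩ := hpt
    rcases Sym2.mem_iff.1 (E.mem_of_pt_mem_edgeArc hz) with rfl | rfl
    · exact Or.inl rfl
    · exact Or.inr rfl
  · exact absurd (E.mem_edges_of_mem_openArc ⟨hz, hpt⟩ hz') hc.2

open Classical in
/-- The increment of `log (· - z)` along the arc of an edge, as a function on pairs of vertices. -/
noncomputable def arcInc (z : ℂ) (u v : V) : ℂ :=
  if h : G.Adj u v then (E.arc h).logIncAt z else 0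

theorem arcInc_eq (h : G.Adj u v) (z : ℂ) : E.arcInc z u v = (E.arc h).logIncAt z := dif_pos h

theorem arcInc_swap {z : ℂ} (hz : z ∉ E.drawing) (h : G.Adj u v) :
    E.arcInc z v u = -E.arcInc z u v := by
  rw [E.arcInc_eq h, E.arcInc_eq h.symm, E.arc_symm h, Path.logIncAt_symm]
  rw [← E.edgeArc_mk h]
  exact fun hz' => hz (E.edgeArc_subset_drawing _ hz')

/-- This turns winding numbers into sums over darts, so that rotating, reversing and splitting walks
become algebra. -/
theorem logIncAt_curve {p : G.Walk u v} {z : ℂ} (hz : z ∉ Set.range (E.curve p)) :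
    (E.curve p).logIncAt z = p.dartSum (E.arcInc z) := by
  induction p with
  | nil => exact Path.logIncAt_refl
  | cons h p ih =>
    rw [curve, Path.trans_range, Set.mem_union, not_or] at hz
    rw [curve, Path.logIncAt_trans _ _ hz.1 hz.2, ih hz.2, SimpleGraph.Walk.dartSum_cons,
      E.arcInc_eq h]

/-! #### Cycles -/

section Cycle

variable {c : G.Walk u u} (hc : c.IsCycle)
include hc

theorem isPreconnected_inside_curve : IsPreconnected (E.curve c).inside := by
  cases c with
  | nil => exact absurd rfl hc.ne_nil
  | cons h p => exact (E.isJordanPair hc).isPreconnected_inside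

theorem isPreconnected_outside_curve : IsPreconnected (E.curve c).outside := by
  cases c with
  | nil => exact absurd rfl hc.ne_nil
  | cons h p => exact (E.isJordanPair hc).isPreconnected_outside

theorem exists_logIncAt_curve_eq_unit : ∃ s : ℤ, (s = 1 ∨ s = -1) ∧
    ∀ z ∈ (E.curve c).inside, (E.curve c).logIncAt z = s * (2 * Real.pi * Complex.I) := by
  cases c with
  | nil => exact absurd rfl hc.ne_nil
  | cons h p => exact (E.isJordanPair hc).exists_logIncAt_eq_unit

/-- Rotating the cycle makes `e` its first edge, the arc to which the results on Jordan pairs apply.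
Rotation changes neither the range nor the winding numbers. -/
theorem openArc_subset_closure {e : Sym2 V} (he : e ∈ c.edges) :
    E.openArc e ⊆ closure (E.curve c).inside ∩ closure (E.curve c).outside := by
  obtain ⟨d, hd, rfl⟩ := List.mem_map.1 he
  obtain ⟨q, r, rfl⟩ := SimpleGraph.Walk.exists_append_cons_of_mem_darts hd
  have hc' := hc.append_comm
  rw [SimpleGraph.Walk.cons_append] at hc'
  have hJ := E.isJordanPair hc'
  have hrange : Set.range (E.curve (q.append (.cons d.adj r))) =
      Set.range (E.curve (.cons d.adj (r.append q))) := by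
    ext z
    rw [E.mem_range_curve_of_not_nil (fun h => hc.ne_nil h.eq_nil),
      E.mem_range_curve_of_not_nil (fun h => hc'.ne_nil h.eq_nil)]
    simp only [SimpleGraph.Walk.edges_append, SimpleGraph.Walk.edges_cons, List.mem_append,
      List.mem_cons]
    simp only [or_left_comm, or_comm]
  have hinc : ∀ z ∉ Set.range (E.curve (q.append (.cons d.adj r))),
      (E.curve (q.append (.cons d.adj r))).logIncAt z =
      (E.curve (.cons d.adj (r.append q))).logIncAt z := by
    intro z hz
    rw [E.logIncAt_curve hz, E.logIncAt_curve (hrange ▸ hz)]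
    simp only [SimpleGraph.Walk.dartSum_append, SimpleGraph.Walk.dartSum_cons]
    ring
  have hin : (E.curve (q.append (.cons d.adj r))).inside =
      (E.curve (.cons d.adj (r.append q))).inside := by
    ext z
    refine and_congr_right_iff.2 (fun hz => by rw [hinc z hz]) |>.trans ?_
    rw [hrange]
    rfl
  have hout : (E.curve (q.append (.cons d.adj r))).outside =
      (E.curve (.cons d.adj (r.append q))).outside := by
    ext z
    refine and_congr_right_iff.2 (fun hz => by rw [hinc z hz]) |>.trans ?_
    rw [hrange]
    rfl
  rw [hin, hout]
  have : d.edge = s(d.fst, d.snd) := rfl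
  rw [this, E.openArc_mk d.adj]
  rintro _ ⟨t, ht, rfl⟩
  exact ⟨hJ.mem_closure_inside ht.1.ne' ht.2.ne, hJ.mem_closure_outside ht.1.ne' ht.2.ne⟩

end Cycle

/-! ### Edges inside a cycle -/

theorem openArc_subset_inside_or_outside {c : G.Walk u u} {e : Sym2 V} (he : e ∈ G.edgeSet)
    (hec : e ∉ c.edges) :
    E.openArc e ⊆ (E.curve c).inside ∨ E.openArc e ⊆ (E.curve c).outside := by
  induction e with
  | _ x y =>
    refine IsPreconnected.subset_or_subset (E.curve c).isOpen_inside (E.curve c).isOpen_outside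
      (E.curve c).disjoint_inside_outside ?_ (E.isPreconnected_openArc he)
    rw [Path.inside_union_outside]
    exact fun z hz hz' => hec (E.mem_edges_of_mem_openArc hz hz')

/-- The graph of the edges that run inside the closed walk `c`. -/
def innerGraph (c : G.Walk u u) : SimpleGraph V where
  Adj x y := G.Adj x y ∧ E.openArc s(x, y) ⊆ (E.curve c).inside
  symm := ⟨fun _ _ h => ⟨h.1.symm, Sym2.eq_swap ▸ h.2⟩⟩
  loopless := ⟨fun _ h => h.1.ne rfl⟩

theorem innerGraph_le (c : G.Walk u u) : E.innerGraph c ≤ G := fun _ _ h => h.1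

section InnerGraph

variable {c : G.Walk u u}

theorem openArc_subset_of_mem_innerGraph {e : Sym2 V} (he : e ∈ (E.innerGraph c).edgeSet) :
    E.openArc e ⊆ (E.curve c).inside := by
  induction e with
  | _ x y => exact he.2

theorem notMem_innerGraph_of_mem_edges {e : Sym2 V} (he : e ∈ c.edges) :
    e ∉ (E.innerGraph c).edgeSet := by
  induction e with
  | _ x y =>
    intro h
    obtain ⟨z, hz⟩ := E.openArc_nonempty (c.adj_of_mem_edges he)
    exact (h.2 hz).1 (E.edgeArc_subset_range_curve he hz.1)

theorem edgeArc_subset_of_mem_innerGraph {e : Sym2 V} (he : e ∈ (E.innerGraph c).edgeSet) :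
    E.edgeArc e ⊆ (E.curve c).inside ∪ Set.range (E.curve c) :=
  (E.edgeArc_subset_closure_openArc e).trans
    ((closure_mono (E.openArc_subset_of_mem_innerGraph he)).trans (E.curve c).closure_inside_subset)

theorem disjoint_inside_edgeArc {e : Sym2 V} (he : e ∉ (E.innerGraph c).edgeSet) :
    Disjoint (E.curve c).inside (E.edgeArc e) := by
  refine Disjoint.mono_right (E.edgeArc_subset_closure_openArc e)
    (Disjoint.closure_right ?_ (E.curve c).isOpen_inside)
  by_cases heG : e ∈ G.edgeSet
  · by_cases hec : e ∈ c.edges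
    · exact Set.disjoint_left.2 fun z hz hz' => hz.1 (E.edgeArc_subset_range_curve hec hz'.1)
    · rcases E.openArc_subset_inside_or_outside heG hec with h | h
      · induction e with
        | _ x y => exact absurd ⟨heG, h⟩ he
      · exact (E.curve c).disjoint_inside_outside.mono_right h
  · rw [openArc, E.edgeArc_eq_empty heG, Set.empty_sdiff]
    exact Set.disjoint_empty _

theorem innerGraph_adj_start (h : (E.innerGraph c).Adj x y) :
    x ∈ c.support ∨ E.pt x ∈ (E.curve c).inside := by
  rcases E.edgeArc_subset_of_mem_innerGraph (e := s(x, y)) h (E.pt_mem_edgeArc h.1) with h | h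
  · exact Or.inr h
  · exact Or.inl (E.pt_mem_range_curve.1 h)

end InnerGraph

/-- A curve inside a cycle has winding number zero around the points outside the cycle. -/
theorem outside_subset_outside {c : G.Walk u u} (hc : c.IsCycle) {a : ℂ} (γ : Path a a)
    (hγ : Set.range γ ⊆ (E.curve c).inside ∪ Set.range (E.curve c)) :
    (E.curve c).outside ⊆ γ.outside := by
  have hdisj : Disjoint (E.curve c).outside (Set.range γ) := by
    refine Set.disjoint_left.2 fun z hz hz' => ?_
    rcases hγ hz' with h | h
    · exact (E.curve c).disjoint_inside_outside.le_bot ⟨h, hz⟩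
    · exact hz.1 h
  intro z hz
  refine ⟨hdisj.notMem_of_mem_left hz, ?_⟩
  -- The outside of the cycle is connected, avoids `γ` and contains points far away, where `γ` has
  -- winding number zero.
  obtain ⟨r, hr0, hr⟩ := (E.curve c).exists_forall_mem_outside
  obtain ⟨s, hs0, hs⟩ := γ.exists_forall_mem_outside
  have hnorm : ‖((max r s + 1 : ℝ) : ℂ)‖ = max r s + 1 := by
    rw [Complex.norm_real, Real.norm_of_nonneg]
    have := le_max_left r s
    linarith
  rw [γ.logIncAt_eq_of_isPreconnected (E.isPreconnected_outside_curve hc) hdisj hz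
    (hr ((max r s + 1 : ℝ) : ℂ) ?_)]
  · refine (hs _ ?_).2
    rw [hnorm]
    exact (le_max_right r s).trans_lt (lt_add_one _)
  · rw [hnorm]
    exact (le_max_left r s).trans_lt (lt_add_one _)

/-- The edges that do not run outside the closed walk `c`. -/
def enclosedEdges (c : G.Walk u u) : Set (Sym2 V) :=
  {e | e ∈ G.edgeSet ∧ ¬ E.openArc e ⊆ (E.curve c).outside}

/-- Makes the induction on cycles terminate. An edge of `c` that `c'` does not use is approached
from the outside of `c`, hence from the outside of `c'`, and so itself runs outside `c'`. -/
theorem enclosedEdges_ssubset {c : G.Walk u u} (hc : c.IsCycle) {c' : G.Walk v v}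
    (hc' : c'.IsCycle) (h : ∀ e ∈ c'.edges, e ∈ c.edges ∨ e ∈ (E.innerGraph c).edgeSet)
    (hex : ∃ e ∈ c.edges, e ∉ c'.edges) : E.enclosedEdges c' ⊂ E.enclosedEdges c := by
  have hsub : (E.curve c).outside ⊆ (E.curve c').outside := by
    refine E.outside_subset_outside hc _ fun z hz => ?_
    obtain ⟨e, he, hz⟩ := (E.mem_range_curve_of_not_nil fun h => hc'.ne_nil h.eq_nil).1 hz
    rcases h e he with h | h
    · exact Or.inr (E.edgeArc_subset_range_curve h hz)
    · exact E.edgeArc_subset_of_mem_innerGraph h hz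
  refine ⟨fun e he => ⟨he.1, fun h => he.2 (h.trans hsub)⟩, fun hcon => ?_⟩
  obtain ⟨e, he, he'⟩ := hex
  have heG := c.edges_subset_edgeSet he
  refine (hcon (⟨heG, fun hout => ?_⟩ : e ∈ E.enclosedEdges c)).2 fun z hz => ?_
  · induction e with
    | _ x y =>
      obtain ⟨z, hz⟩ := E.openArc_nonempty heG
      exact (hout hz).1 (E.edgeArc_subset_range_curve he hz.1)
  · have hz' : z ∉ Set.range (E.curve c') := fun h => he' (E.mem_edges_of_mem_openArc hz h)
    refine ⟨hz', ?_⟩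
    obtain ⟨w, hw, hw'⟩ := ((mem_closure_iff_frequently.1
      (E.openArc_subset_closure hc he hz).2).and_eventually
      ((E.curve c').logIncAt_eventually_eq hz')).exists
    rw [← hw'.2]
    exact (hsub hw).2

/-- A nonvanishing function on the drawing has a logarithm if its increments along the arcs come from
logarithms of its values at the vertices. -/
theorem hasLogOn_drawing [Finite V] {f : ℂ → ℂ} (hf : ContinuousOn f E.drawing)
    (h0 : ∀ z ∈ E.drawing, f z ≠ 0) {φ : V → ℂ} (hφ : ∀ v, Complex.exp (φ v) = f (E.pt v))
    (hinc : ∀ u v (h : G.Adj u v), logInc (fun t => f (E.arc h t)) = φ v - φ u) :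
    HasLogOn f E.drawing := by
  classical
  have hloc : ∀ e, ∃ L : ℂ → ℂ, ContinuousOn L (E.edgeArc e) ∧
      (∀ z ∈ E.edgeArc e, f z = Complex.exp (L z)) ∧
      ∀ v, E.pt v ∈ E.edgeArc e → L (E.pt v) = φ v := by
    intro e
    by_cases he : e ∈ G.edgeSet
    · induction e with
      | _ u v =>
        have hsub := E.edgeArc_subset_drawing s(u, v)
        have hmem : ∀ w, E.pt w ∈ E.edgeArc s(u, v) → w = u ∨ w = v := fun w hw =>
          Sym2.mem_iff.1 (E.mem_of_pt_mem_edgeArc hw)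
        rw [E.edgeArc_mk he] at *
        obtain ⟨L, hL, hL'⟩ := LogTrivial.range (E.arc he).continuous (E.arc_injective he) f
          (hf.mono hsub) fun z hz => h0 z (hsub hz)
        have hLinc := HasLogOn.logInc_eq hL hL' (E.arc he) subset_rfl
        change _ = L (E.pt v) - L (E.pt u) at hLinc
        rw [hinc u v he] at hLinc
        -- The shift gives the value `φ u` at one endpoint; the prescribed increment then gives `φ
        -- v` at the other.
        refine ⟨fun z => L z + (φ u - L (E.pt u)), by fun_prop, fun z hz => ?_, fun w hw => ?_⟩
        · rw [Complex.exp_add, Complex.exp_sub, hφ, ← hL' (E.pt u) ⟨0, (E.arc he).source⟩,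
            div_self (h0 _ (E.pt_mem_drawing u)), mul_one, hL' z hz]
        · rcases hmem w hw with rfl | rfl
          · ring
          · linear_combination -hLinc
    · rw [E.edgeArc_eq_empty he]
      exact ⟨0, continuousOn_empty _, fun z hz => hz.elim, fun v hv => hv.elim⟩
  choose L hL hL' hLφ using hloc
  let M : ℂ → ℂ := fun z =>
    if h : ∃ v, E.pt v = z then φ h.choose
    else if h : ∃ e, z ∈ E.edgeArc e then L h.choose z else 0
  have hMpt : ∀ v, M (E.pt v) = φ v := by
    intro v
    have h : ∃ w, E.pt w = E.pt v := ⟨v, rfl⟩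
    simp only [M, dif_pos h]
    rw [E.pt_injective h.choose_spec]
  have hMarc : ∀ e, ∀ z ∈ E.edgeArc e, M z = L e z := by
    intro e z hz
    by_cases hpt : ∃ v, E.pt v = z
    · obtain ⟨v, rfl⟩ := hpt
      rw [hMpt, hLφ e v hz]
    · have h : ∃ e, z ∈ E.edgeArc e := ⟨e, hz⟩
      simp only [M, dif_neg hpt, dif_pos h]
      rw [E.eq_of_mem_openArc ⟨hz, fun ⟨v, hv⟩ => hpt ⟨v, hv⟩⟩ h.choose_spec]
  let S : V ⊕ Sym2 V → Set ℂ := Sum.elim (fun v => {E.pt v}) E.edgeArc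
  have hS : E.drawing = ⋃ i, S i := by
    rw [drawing_eq, Set.iUnion_sum]
    simp only [S, Sum.elim_inl, Sum.elim_inr, Set.iUnion_singleton_eq_range]
  refine ⟨M, ?_, ?_⟩
  · rw [hS]
    refine (locallyFinite_of_finite S).continuousOn_iUnion ?_ ?_
    · rintro (v | e)
      · exact isClosed_singleton
      · exact (E.isCompact_edgeArc e).isClosed
    · rintro (v | e)
      · exact continuousOn_singleton _ _
      · exact (hL e).congr (hMarc e)
  · intro z hz
    rw [hS] at hz
    obtain ⟨v | e, hz⟩ := Set.mem_iUnion.1 hz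
    · rw [Set.mem_singleton_iff.1 hz, hMpt, hφ]
    · rw [hMarc e z hz, hL' e z hz]

end PlaneEmbedding

namespace PlaneEmbedding

variable {V : Type*} {G : SimpleGraph V} (E : PlaneEmbedding G) {u v x y : V}

/-! #### Minimal cycles bound faces -/

/-- Near an edge of the cycle `c`, closed walks inside `c` have winding number zero. -/
theorem eventually_dartSum_innerGraph_eq_zero [Finite V] {c : G.Walk u u} (hc : c.IsCycle)
    {e : Sym2 V} (he : e ∈ c.edges) {z : ℂ} (hz : z ∈ E.openArc e) :
    ∀ᶠ p in nhds z, p ∈ (E.curve c).inside → p ∉ E.drawing ∧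
      ∀ (a : V) (D : (E.innerGraph c).Walk a a), D.dartSum (E.arcInc p) = 0 := by
  -- `K` is the drawing without the open arc of `e`. A small ball around `z` misses `K`, hence every
  -- closed walk of inner edges, and it contains points outside `c`, where such walks have winding
  -- number zero.
  let K : Set ℂ := Set.range E.pt ∪ ⋃ e' : {e' : Sym2 V // e' ≠ e}, E.edgeArc e'
  have hK : IsClosed K := (Set.finite_range _).isClosed.union
    (isClosed_iUnion_of_finite fun e' => (E.isCompact_edgeArc _).isClosed)
  have hzK : z ∉ K := by
    rintro (h | h)
    · exact hz.2 h
    · obtain ⟨e', h⟩ := Set.mem_iUnion.1 h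
      exact e'.2 (E.eq_of_mem_openArc hz h)
  obtain ⟨ε, hε, hball⟩ := Metric.isOpen_iff.1 hK.isOpen_compl z hzK
  filter_upwards [Metric.ball_mem_nhds z hε] with p hp hpin
  have hdraw : p ∉ E.drawing := by
    rw [drawing_eq]
    rintro (h | h)
    · exact hball hp (Or.inl h)
    · obtain ⟨e', h⟩ := Set.mem_iUnion.1 h
      by_cases hee : e' = e
      · subst hee
        exact hpin.1 (E.edgeArc_subset_range_curve he h)
      · exact hball hp (Or.inr (Set.mem_iUnion.2 ⟨⟨e', hee⟩, h⟩))
  refine ⟨hdraw, fun a D => ?_⟩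
  rw [← SimpleGraph.Walk.dartSum_mapLe (E.innerGraph_le c),
    ← E.logIncAt_curve fun h => hdraw (E.range_curve_subset_drawing _ h)]
  by_cases hnil : (D.mapLe (E.innerGraph_le c)).Nil
  · rw [hnil.eq_nil]
    exact Path.logIncAt_refl
  have hmem : ∀ w ∈ Set.range (E.curve (D.mapLe (E.innerGraph_le c))),
      ∃ e' ∈ (E.innerGraph c).edgeSet, w ∈ E.edgeArc e' := by
    intro w hw
    obtain ⟨e', he', hw⟩ := (E.mem_range_curve_of_not_nil hnil).1 hw
    rw [SimpleGraph.Walk.edges_mapLe_eq_edges] at he'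
    exact ⟨e', D.edges_subset_edgeSet he', hw⟩
  have hsub := E.outside_subset_outside hc (E.curve (D.mapLe (E.innerGraph_le c))) fun w hw => by
    obtain ⟨e', he', hw⟩ := hmem w hw
    exact E.edgeArc_subset_of_mem_innerGraph he' hw
  obtain ⟨w, hw, hwout⟩ := mem_closure_iff.1 (E.openArc_subset_closure hc he hz).2 _
    Metric.isOpen_ball (Metric.mem_ball_self hε)
  rw [(E.curve _).logIncAt_eq_of_isPreconnected (convex_ball z ε).isPreconnected
    (Set.disjoint_left.2 fun w hw hw' => ?_) hp hw]
  · exact (hsub hwout).2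
  · obtain ⟨e', he', hw'⟩ := hmem w hw'
    refine hball hw (Or.inr (Set.mem_iUnion.2 ⟨⟨e', ?_⟩, hw'⟩))
    rintro rfl
    exact E.notMem_innerGraph_of_mem_edges he he'

/-- A closed walk without edges inside the cycle `c` has constant winding number inside `c`. -/
theorem dartSum_eq_of_outer {c : G.Walk u u} (hc : c.IsCycle) {p q : ℂ}
    (hp : p ∈ (E.curve c).inside) (hq : q ∈ (E.curve c).inside) (hpd : p ∉ E.drawing)
    (hqd : q ∉ E.drawing) {a : V} (D : (G \ E.innerGraph c).Walk a a) :
    D.dartSum (E.arcInc p) = D.dartSum (E.arcInc q) := by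
  have hle : G \ E.innerGraph c ≤ G := sdiff_le
  rw [← SimpleGraph.Walk.dartSum_mapLe hle, ← SimpleGraph.Walk.dartSum_mapLe hle,
    ← E.logIncAt_curve fun h => hpd (E.range_curve_subset_drawing _ h),
    ← E.logIncAt_curve fun h => hqd (E.range_curve_subset_drawing _ h)]
  by_cases hnil : (D.mapLe hle).Nil
  · rw [hnil.eq_nil]
    exact Path.logIncAt_refl.trans Path.logIncAt_refl.symm
  refine (E.curve _).logIncAt_eq_of_isPreconnected (E.isPreconnected_inside_curve hc)
    (Set.disjoint_left.2 fun w hw hw' => ?_) hp hq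
  obtain ⟨e, he, hw'⟩ := (E.mem_range_curve_of_not_nil hnil).1 hw'
  rw [SimpleGraph.Walk.edges_mapLe_eq_edges] at he
  have he' : e ∉ (E.innerGraph c).edgeSet := by
    have := D.edges_subset_edgeSet he
    rw [SimpleGraph.edgeSet_sdiff] at this
    exact this.2
  exact (E.disjoint_inside_edgeArc he').le_bot ⟨hw, hw'⟩

/-- The increments `w` of `log ((z - p) / (z - q))` sum to zero on closed walks of inner edges by
`hp0` and `hq0`, and on closed walks of other edges because `p` and `q` lie on the same side of
them. This gives two potentials. They can be matched because each component of the inner graph meets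
the cycle in at most one vertex. -/
theorem hasLogOn_drawing_of_no_chord [Finite V] {c : G.Walk u u} (hc : c.IsCycle)
    (hchord : ∀ x ∈ c.support, ∀ y ∈ c.support, (E.innerGraph c).Reachable x y → x = y) {p q : ℂ}
    (hp : p ∈ (E.curve c).inside) (hq : q ∈ (E.curve c).inside) (hpd : p ∉ E.drawing)
    (hqd : q ∉ E.drawing)
    (hp0 : ∀ (a : V) (D : (E.innerGraph c).Walk a a), D.dartSum (E.arcInc p) = 0)
    (hq0 : ∀ (a : V) (D : (E.innerGraph c).Walk a a), D.dartSum (E.arcInc q) = 0) :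
    HasLogOn (fun z => (z - p) / (z - q)) E.drawing := by
  classical
  have hpz : ∀ z ∈ E.drawing, z - p ≠ 0 := fun z hz h0 => hpd (by rwa [← sub_eq_zero.1 h0])
  have hqz : ∀ z ∈ E.drawing, z - q ≠ 0 := fun z hz h0 => hqd (by rwa [← sub_eq_zero.1 h0])
  set w : V → V → ℂ := fun x y => E.arcInc p x y - E.arcInc q x y with hw
  have hrange : ∀ {x y} (h : G.Adj x y) {z : ℂ}, z ∉ E.drawing → z ∉ Set.range (E.arc h) :=
    fun h z hz hz' => hz (E.edgeArc_subset_drawing _ (by rwa [E.edgeArc_mk h]))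
  have hswap : ∀ x y, G.Adj x y → w y x = -w x y := by
    intro x y h
    simp only [hw, E.arcInc_swap hpd h, E.arcInc_swap hqd h]
    ring
  have hstep : ∀ x y (a : ℂ), G.Adj x y → Complex.exp a = (E.pt x - p) / (E.pt x - q) →
      Complex.exp (a + w x y) = (E.pt y - p) / (E.pt y - q) := by
    intro x y a h ha
    have h1 := hpz _ (E.pt_mem_drawing x)
    have h2 := hqz _ (E.pt_mem_drawing x)
    have h3 := hpz _ (E.pt_mem_drawing y)
    have h4 := hqz _ (E.pt_mem_drawing y)
    rw [Complex.exp_add, ha, hw]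
    simp only
    rw [Complex.exp_sub, E.arcInc_eq h, E.arcInc_eq h, Path.exp_logIncAt _ (hrange h hpd),
      Path.exp_logIncAt _ (hrange h hqd)]
    field_simp
  have hex : ∀ v, ∃ a, Complex.exp a = (E.pt v - p) / (E.pt v - q) := fun v =>
    ⟨_, Complex.exp_log (div_ne_zero (hpz _ (E.pt_mem_drawing v)) (hqz _ (E.pt_mem_drawing v)))⟩
  have hle := E.innerGraph_le c
  have hle' : G \ E.innerGraph c ≤ G := sdiff_le
  obtain ⟨φ, hφ, hφw⟩ := SimpleGraph.exists_potential (G := E.innerGraph c) (w := w)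
    (fun a D => by rw [SimpleGraph.Walk.dartSum_sub, hp0, hq0, sub_self])
    (fun x y h => hswap x y (hle h)) hex fun x y a h => hstep x y a (hle h)
  obtain ⟨ψ, hψ, hψw⟩ := SimpleGraph.exists_potential (G := G \ E.innerGraph c) (w := w)
    (fun a D => by
      rw [SimpleGraph.Walk.dartSum_sub, E.dartSum_eq_of_outer hc hp hq hpd hqd, sub_self])
    (fun x y h => hswap x y (hle' h)) hex fun x y a h => hstep x y a (hle' h)
  -- On an inner component attached to the cycle, `φ` is shifted to agree with `ψ` at the unique
  -- attaching vertex.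
  let θ : V → ℂ := fun v =>
    if h : ∃ x ∈ c.support, (E.innerGraph c).Reachable v x then φ v + (ψ h.choose - φ h.choose)
    else if E.pt v ∈ (E.curve c).inside then φ v else ψ v
  have hθ : ∀ {v x}, x ∈ c.support → (E.innerGraph c).Reachable v x →
      θ v = φ v + (ψ x - φ x) := by
    intro v x hx hvx
    have h : ∃ x ∈ c.support, (E.innerGraph c).Reachable v x := ⟨x, hx, hvx⟩
    simp only [θ, dif_pos h]
    rw [hchord _ h.choose_spec.1 _ hx (h.choose_spec.2.symm.trans hvx)]
  have hθout : ∀ v, E.pt v ∉ (E.curve c).inside → θ v = ψ v := by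
    intro v hv
    by_cases h : ∃ x ∈ c.support, (E.innerGraph c).Reachable v x
    · obtain ⟨x, hx, ⟨r⟩⟩ := h
      have hvc : v ∈ c.support := by
        cases r with
        | nil => exact hx
        | cons h r => exact (E.innerGraph_adj_start h).resolve_right hv
      rw [hθ hvc (SimpleGraph.Reachable.refl v)]
      ring
    · simp only [θ, dif_neg h, if_neg hv]
  have hθexp : ∀ v, Complex.exp (θ v) = (E.pt v - p) / (E.pt v - q) := by
    intro v
    simp only [θ]
    split_ifs with h1 h2
    · rw [Complex.exp_add, Complex.exp_sub, hφ, hφ, hψ, div_self, mul_one]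
      exact div_ne_zero (hpz _ (E.pt_mem_drawing _)) (hqz _ (E.pt_mem_drawing _))
    · exact hφ v
    · exact hψ v
  have hθw : ∀ x y, G.Adj x y → w x y = θ y - θ x := by
    intro x y h
    by_cases hin : (E.innerGraph c).Adj x y
    · rw [hφw x y hin]
      by_cases h1 : ∃ z ∈ c.support, (E.innerGraph c).Reachable x z
      · obtain ⟨z, hz, hxz⟩ := h1
        rw [hθ hz hxz, hθ hz (hin.symm.reachable.trans hxz)]
        ring
      · have h2 : ¬ ∃ z ∈ c.support, (E.innerGraph c).Reachable y z := by
          rintro ⟨z, hz, hyz⟩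
          exact h1 ⟨z, hz, hin.reachable.trans hyz⟩
        have hx : E.pt x ∈ (E.curve c).inside := (E.innerGraph_adj_start hin).resolve_left
          fun hx => h1 ⟨x, hx, SimpleGraph.Reachable.refl x⟩
        have hy : E.pt y ∈ (E.curve c).inside := (E.innerGraph_adj_start hin.symm).resolve_left
          fun hy => h2 ⟨y, hy, SimpleGraph.Reachable.refl y⟩
        simp only [θ, dif_neg h1, dif_neg h2, if_pos hx, if_pos hy]
    · have hd := E.disjoint_inside_edgeArc (c := c) (e := s(x, y)) hin
      rw [hψw x y ⟨h, hin⟩, hθout x (hd.notMem_of_mem_right (E.pt_mem_edgeArc h)),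
        hθout y (hd.notMem_of_mem_right (Sym2.eq_swap ▸ E.pt_mem_edgeArc h.symm))]
  refine E.hasLogOn_drawing (φ := θ) (by fun_prop (disch := exact hqz))
    (fun z hz => div_ne_zero (hpz z hz) (hqz z hz)) hθexp fun x y h => ?_
  rw [← hθw x y h, logInc_div (by fun_prop) (Path.sub_ne_zero_of_notMem_range _ (hrange h hpd))
    (by fun_prop) (Path.sub_ne_zero_of_notMem_range _ (hrange h hqd)), hw]
  simp only
  rw [E.arcInc_eq h, E.arcInc_eq h, Path.logIncAt, Path.logIncAt]

/-- A cycle without chords in its interior bounds a face from outside. -/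
theorem exists_face_of_no_chord [Finite V] {c : G.Walk u u} (hc : c.IsCycle)
    (hchord : ∀ x ∈ c.support, ∀ y ∈ c.support, (E.innerGraph c).Reachable x y → x = y) :
    ∃ f, E.IsFace f ∧ f ⊆ (E.curve c).inside ∧ Set.range (E.curve c) ⊆ frontier f := by
  -- Points close to the cycle on its inner side have winding number zero for all closed inner
  -- walks. Any two such points lie in the same face, which therefore accumulates at every edge of
  -- the cycle.
  have hnear : ∀ e ∈ c.edges, ∀ z ∈ E.openArc e, ∀ W ∈ nhds z, ∃ p ∈ W,
      p ∈ (E.curve c).inside ∧ p ∉ E.drawing ∧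
        ∀ (a : V) (D : (E.innerGraph c).Walk a a), D.dartSum (E.arcInc p) = 0 := by
    intro e he z hz W hW
    obtain ⟨p, hp, hp', hpW⟩ := ((mem_closure_iff_frequently.1
      (E.openArc_subset_closure hc he hz).1).and_eventually
      ((E.eventually_dartSum_innerGraph_eq_zero hc he hz).and hW)).exists
    exact ⟨p, hpW, hp, hp' hp⟩
  have hnil : ¬ c.Nil := fun h => hc.ne_nil h.eq_nil
  obtain ⟨e₀, he₀⟩ := List.exists_mem_of_ne_nil _ fun h =>
    hnil (SimpleGraph.Walk.edges_eq_nil.1 h)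
  obtain ⟨z₀, hz₀⟩ : (E.openArc e₀).Nonempty := by
    have := c.edges_subset_edgeSet he₀
    induction e₀ with
    | _ x y => exact E.openArc_nonempty this
  obtain ⟨p, -, hp, hpd, hp0⟩ := hnear e₀ he₀ z₀ hz₀ _ Filter.univ_mem
  have hK := E.isCompact_drawing
  have hopen : IsOpen (connectedComponentIn E.drawingᶜ p) :=
    hK.isClosed.isOpen_compl.connectedComponentIn
  have hdisj : Disjoint (connectedComponentIn E.drawingᶜ p) (Set.range (E.curve c)) :=
    Set.disjoint_left.2 fun z hz hz' =>
      connectedComponentIn_subset _ _ hz (E.range_curve_subset_drawing c hz')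
  refine ⟨connectedComponentIn E.drawingᶜ p, ⟨p, hpd, rfl⟩, fun z hz => ?_, fun z hz => ?_⟩
  · refine ⟨hdisj.notMem_of_mem_left hz, ?_⟩
    rw [(E.curve c).logIncAt_eq_of_isPreconnected isPreconnected_connectedComponentIn hdisj hz
      (mem_connectedComponentIn hpd)]
    exact hp.2
  · refine ⟨?_, fun h => hdisj.le_bot ⟨interior_subset h, hz⟩⟩
    obtain ⟨e, he, hz⟩ := (E.mem_range_curve_of_not_nil hnil).1 hz
    refine closure_minimal ?_ isClosed_closure (E.edgeArc_subset_closure_openArc e hz)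
    intro z hz
    refine mem_closure_iff_nhds.2 fun W hW => ?_
    obtain ⟨q, hqW, hq, hqd, hq0⟩ := hnear e he z hz W hW
    refine ⟨q, hqW, ?_⟩
    rw [connectedComponentIn_eq_of_hasLogOn hK hpd hqd
      (E.hasLogOn_drawing_of_no_chord hc hchord hp hq hpd hqd hp0 hq0)]
    exact mem_connectedComponentIn hqd

theorem isFace_subset_compl {f : Set ℂ} (hf : E.IsFace f) : f ⊆ E.drawingᶜ := by
  obtain ⟨z, -, rfl⟩ := hf
  exact connectedComponentIn_subset _ _

/-- A cycle that bounds a face from outside runs clockwise around it in one of its directions. -/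
theorem enclosesClockwise_or_reverse {c : G.Walk u u} (hc : c.IsCycle) {f : Set ℂ}
    (hf : E.IsFace f) (hin : f ⊆ (E.curve c).inside)
    (hfr : Set.range (E.curve c) ⊆ frontier f) :
    E.EnclosesClockwise c f ∨ E.EnclosesClockwise c.reverse f := by
  obtain ⟨s, hs, hs'⟩ := E.exists_logIncAt_curve_eq_unit hc
  have hd := E.isFace_subset_compl hf
  have hoff : ∀ z ∈ f, ∀ {v} (c : G.Walk v v), z ∉ Set.range (E.curve c) := fun z hz _ c h =>
    hd hz (E.range_curve_subset_drawing c h)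
  rcases hs with rfl | rfl
  · right
    refine ⟨hc.reverse, fun z hz => hfr ?_, fun z hz => ?_⟩
    · rw [mem_range_curve] at hz ⊢
      simpa using hz
    · rw [Path.hasWindingNumber_iff _ (hoff z hz _), E.logIncAt_curve (hoff z hz _),
        SimpleGraph.Walk.dartSum_reverse (fun x y h => E.arcInc_swap (hd hz) h),
        ← E.logIncAt_curve (hoff z hz _), hs' z (hin hz)]
      push_cast
      ring
  · left
    refine ⟨hc, hfr, fun z hz => ?_⟩
    rw [Path.hasWindingNumber_iff _ (hoff z hz _), hs' z (hin hz)]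

/-- An antisymmetric weight that sums to zero on the cycles enclosing bounded faces sums to zero on
all cycles. -/
theorem dartSum_eq_zero_of_enclosesClockwise [Finite V] {A : Type*} [AddCommGroup A]
    {w : V → V → A} (hw : ∀ u v, G.Adj u v → w v u = -w u v)
    (h : ∀ f, E.IsFace f → Bornology.IsBounded f → ∀ (u : V) (c : G.Walk u u),
      E.EnclosesClockwise c f → c.dartSum w = 0) {u : V} {c : G.Walk u u} (hc : c.IsCycle) :
    c.dartSum w = 0 := by
  induction hn : (E.enclosedEdges c).ncard using Nat.strong_induction_on generalizing u c with
  | _ n ih =>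
    subst hn
    -- Without a chord the cycle encloses a face, clockwise in one of its two directions; with a
    -- chord it splits into two smaller cycles.
    by_cases hchord : ∀ x ∈ c.support, ∀ y ∈ c.support, (E.innerGraph c).Reachable x y → x = y
    · obtain ⟨f, hf, hin, hfr⟩ := E.exists_face_of_no_chord hc hchord
      have hb := (E.curve c).isBounded_inside.subset hin
      rcases E.enclosesClockwise_or_reverse hc hf hin hfr with hcw | hcw
      · exact h f hf hb u c hcw
      · have := h f hf hb u _ hcw
        rwa [SimpleGraph.Walk.dartSum_reverse hw, neg_eq_zero] at this
    · push Not at hchord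
      obtain ⟨x, hx, y, hy, hreach, hne⟩ := hchord
      obtain ⟨z, c₁, c₂, h1, h2, he1, he2, hex1, hex2, hsum⟩ := hc.exists_of_reachable (A := A)
        (E.innerGraph_le c) (fun e he => E.notMem_innerGraph_of_mem_edges he) hx hy hne hreach
      refine hsum w hw (ih _ ?_ h1 rfl) (ih _ ?_ h2 rfl)
      · exact Set.ncard_lt_ncard (E.enclosedEdges_ssubset hc h1 he1 hex1) (Set.toFinite _)
      · exact Set.ncard_lt_ncard (E.enclosedEdges_ssubset hc h2 he2 hex2) (Set.toFinite _)

end PlaneEmbedding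

/-! ### Comparison of Pfaffian orientations -/

namespace GraphOrientation

variable {V : Type*} {G : SimpleGraph V}

theorem dir_swap_iff (O : GraphOrientation G) {u v : V} (h : G.Adj u v) :
    O.dir v u ↔ ¬ O.dir u v :=
  ⟨fun h1 h2 => O.asymm h1 h2, fun h1 => (O.dir_or_dir h).resolve_left h1⟩

open Classical in
/-- Two Pfaffian orientations of a plane graph differ by switching at a set of vertices. -/
theorem IsPfaffian.exists_switching [Finite V] {E : PlaneEmbedding G} {O O' : GraphOrientation G}
    (hO : O.IsPfaffian E) (hO' : O'.IsPfaffian E) :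
    ∃ s : V → Prop, ∀ u v, G.Adj u v → ((O.dir u v ↔ O'.dir u v) ↔ (s u ↔ s v)) := by
  let b : Prop → ZMod 2 := fun P => if P then 1 else 0
  -- This is 1 exactly on the edges where the orientations disagree; modulo 2, symmetry and
  -- antisymmetry are the same.
  let w : V → V → ZMod 2 := fun u v => b (O.dir u v) + b (O'.dir u v)
  have hw : ∀ u v, G.Adj u v → w v u = -w u v := by
    intro u v h
    simp only [w, b, O.dir_swap_iff h, O'.dir_swap_iff h]
    by_cases h1 : O.dir u v <;> by_cases h2 : O'.dir u v <;> simp [h1, h2] <;> decide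
  have hcount : ∀ (l : List G.Dart), (l.map fun d => w d.fst d.snd).sum =
      ((l.countP fun d => O.dir d.fst d.snd : ℕ) : ZMod 2) +
        ((l.countP fun d => O'.dir d.fst d.snd : ℕ) : ZMod 2) := by
    intro l
    induction l with
    | nil => simp
    | cons d l ih =>
      rw [List.map_cons, List.sum_cons, ih, List.countP_cons, List.countP_cons]
      simp only [w, b, decide_eq_true_eq]
      push_cast
      ring
  have hcyc := fun u (c : G.Walk u u) (hc : c.IsCycle) =>
    E.dartSum_eq_zero_of_enclosesClockwise hw (fun f hf hb u c hcf => by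
      rw [SimpleGraph.Walk.dartSum, hcount, (ZMod.natCast_eq_one_iff_odd).2 (hO f hf hb u c hcf),
        (ZMod.natCast_eq_one_iff_odd).2 (hO' f hf hb u c hcf)]
      decide) hc
  obtain ⟨φ, -, hφ⟩ := SimpleGraph.exists_potential
    (fun u c => SimpleGraph.Walk.dartSum_eq_zero_of_forall_isCycle hw hcyc c) hw
    (P := fun _ _ => True) (fun _ => ⟨0, trivial⟩) (fun _ _ _ _ _ => trivial)
  refine ⟨fun v => φ v = 0, fun u v h => ?_⟩
  have hzmod : ∀ a : ZMod 2, a = 0 ∨ a = 1 := by decide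
  have := hφ u v h
  simp only [w, b] at this
  by_cases h1 : O.dir u v <;> by_cases h2 : O'.dir u v <;>
    rcases hzmod (φ u) with h3 | h3 <;> rcases hzmod (φ v) with h4 | h4 <;>
    simp only [h1, h2, h3, h4, if_true, if_false] at this ⊢ <;> revert this <;> decide

end GraphOrientation

/-! ### Switching and determinants -/

namespace GraphOrientation

variable {V : Type*} {G : SimpleGraph V} {R : Type*} [CommRing R]

theorem genAdjMatrix_of_adj (O : GraphOrientation G) (x : V → R) (a : Sym2 V → R) {u v : V}
    (h : G.Adj u v) [Decidable (O.dir u v)] :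
    O.genAdjMatrix x a u v = if O.dir u v then a s(u, v) else -a s(u, v) := by
  have := O.dir_swap_iff h
  simp only [genAdjMatrix, Matrix.of_apply, if_neg h.ne, this]
  by_cases h' : O.dir u v <;> simp [h']

theorem genAdjMatrix_of_not_adj (O : GraphOrientation G) (x : V → R) (a : Sym2 V → R) {u v : V}
    (hne : u ≠ v) (h : ¬ G.Adj u v) : O.genAdjMatrix x a u v = 0 := by
  have h1 : ¬ O.dir u v := fun h' => h (O.adj_of_dir h')
  have h2 : ¬ O.dir v u := fun h' => h (O.adj_of_dir h').symm
  simp [genAdjMatrix, hne, h1, h2]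

/-- Switching an orientation conjugates the generalised adjacency matrix by a diagonal matrix. -/
theorem det_genAdjMatrix_eq_of_switching [Fintype V] [DecidableEq V] {O O' : GraphOrientation G}
    (d : V → R) (hd : ∀ v, d v * d v = 1)
    (h : ∀ u v, G.Adj u v → (d u * d v = 1 ∧ (O.dir u v ↔ O'.dir u v)) ∨
      (d u * d v = -1 ∧ (O.dir u v ↔ ¬ O'.dir u v))) (x : V → R) (a : Sym2 V → R) :
    (O.genAdjMatrix x a).det = (O'.genAdjMatrix x a).det := by
  classical
  have hM : O.genAdjMatrix x a = Matrix.diagonal d * O'.genAdjMatrix x a * Matrix.diagonal d := by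
    ext u v
    rw [Matrix.mul_diagonal, Matrix.diagonal_mul, mul_right_comm]
    by_cases huv : u = v
    · subst huv
      rw [hd, one_mul]
      simp [genAdjMatrix]
    by_cases hadj : G.Adj u v
    · rw [genAdjMatrix_of_adj _ _ _ hadj, genAdjMatrix_of_adj _ _ _ hadj]
      rcases h u v hadj with ⟨h1, h2⟩ | ⟨h1, h2⟩
      · simp only [h1, h2, one_mul]
      · by_cases h3 : O'.dir u v <;> simp [h1, h2, h3]
    · rw [genAdjMatrix_of_not_adj _ _ _ huv hadj, genAdjMatrix_of_not_adj _ _ _ huv hadj, mul_zero]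
  rw [hM, Matrix.det_mul, Matrix.det_mul, mul_right_comm, ← Matrix.det_mul,
    Matrix.diagonal_mul_diagonal]
  simp [hd]

end GraphOrientation

/-- The parity does not involve `O`, so two product orientations agree on an edge exactly when the
factor orientations agree on its projection. -/
theorem orientedProduct_dir_iff {k : ℕ} {n : Fin k → ℕ} {G : ∀ i, SimpleGraph (Fin (n i))}
    (O : ∀ i, GraphOrientation (G i)) {u v : ∀ i, Fin (n i)} {i : Fin k}
    (hadj : (G i).Adj (u i) (v i)) (h : ∀ j, j ≠ i → u j = v j) :
    (orientedProduct O).dir u v ↔ (Even (labelSum i u) ↔ (O i).dir (u i) (v i)) := by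
  have hswap := (O i).dir_swap_iff hadj
  constructor
  · rintro ⟨j, hj, hdir⟩
    obtain rfl : i = j := by
      by_contra hij
      exact hadj.ne (hj i hij)
    tauto
  · intro h'
    exact ⟨i, h, by tauto⟩

theorem mainTheorem2 {k : ℕ} (n : Fin k → ℕ) (G : ∀ i, SimpleGraph (Fin (n i)))
    (E : ∀ i, PlaneEmbedding (G i)) (O O' : ∀ i, GraphOrientation (G i))
    (hO : ∀ i, (O i).IsPfaffian (E i)) (hO' : ∀ i, (O' i).IsPfaffian (E i))
    {R : Type*} [CommRing R] (x : (∀ i, Fin (n i)) → R) (a : Sym2 (∀ i, Fin (n i)) → R) :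
    ((orientedProduct O).genAdjMatrix x a).det = ((orientedProduct O').genAdjMatrix x a).det := by
  classical
  choose s hs using fun i => (hO i).exists_switching (hO' i)
  let ε : ∀ i, Fin (n i) → R := fun i v => if s i v then 1 else -1
  have hε : ∀ i v, ε i v * ε i v = 1 := by
    intro i v
    simp only [ε]
    split_ifs <;> simp
  -- The switching function of the product is the product of the switching signs of the factors; on
  -- an edge only the factor of the changing coordinate survives, as the other signs are squared.
  refine GraphOrientation.det_genAdjMatrix_eq_of_switching (fun u => ∏ i, ε i (u i))
    (fun u => by simp only [← Finset.prod_mul_distrib, hε, Finset.prod_const_one]) ?_ x a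
  rintro u v ⟨i, hadj, h⟩
  have hprod : (∏ j, ε j (u j)) * ∏ j, ε j (v j) = ε i (u i) * ε i (v i) := by
    rw [← Finset.prod_mul_distrib]
    refine Finset.prod_eq_single i (fun j _ hj => ?_) (by simp)
    rw [h j hj, hε]
  have hsi := hs i (u i) (v i) hadj
  simp only [hprod, orientedProduct_dir_iff _ hadj h, ε]
  by_cases h1 : s i (u i) <;> by_cases h2 : s i (v i) <;> simp only [h1, h2] at hsi ⊢
  · left; refine ⟨by simp, by tauto⟩
  · right; refine ⟨by simp, by tauto⟩
  · right; refine ⟨by simp, by tauto⟩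
  · left; refine ⟨by simp, by tauto⟩
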